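/- Let $\Theta\subset\mathbb R^r$ be compact and convex, and let $\theta_0$ be an interior point of $\Theta$. Let $(\mathcal X,\mu)$ be a $\sigma$-finite measure space and $\mathcal Y$ a countable set of labels. For each $\theta\in\Theta$ let $p_\theta(x,y)>0$ be a probability density on $\mathcal X\times\mathcal Y$ with respect to $m=\mu\otimes(\text{counting measure})$, with marginal $p_\theta(x)=\sum_y p_\theta(x,y)<\infty$. Write $P_{\theta_0}$ and $\operatorname{Var}_{\theta_0}$ for probability and variance matrix under $p_{\theta_0}$. Assume the following. 1. Identifiability: if $\theta\ne\eta$ in $\Theta$, then $p_\theta(x,y)-p_\eta(x,y)$ does not vanish $m$-almost everywhere. 2. Smoothness and the usual domination conditions. Each of the two families $f_\theta=p_\theta(x,y)$ (reference measure $m$) and $f_\theta=p_\theta(x)$ (reference measure $\mu$) is twice continuously differentiable in $\theta\in\Theta$ and satisfies, for almost every argument: (a) $|\log f_\theta|\le K$ for all $\theta\in\Theta$, for some $P_{\theta_0}$-integrable function $K$; (b) $\|\nabla^2_\theta\log f_\theta\|\le K'$ for all $\theta$ in some neighbourhood of $\theta_0$, for some $P_{\theta_0}$-integrable $K'$; (c)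 $\|\nabla_\theta f_\theta\|\le G$ and $\|\nabla^2_\theta f_\theta\|\le G$ for all $\theta$ in some neighbourhood of $\theta_0$, for some $G$ integrable with respect to the reference measure. (If $\mathcal X$ and $\mathcal Y$ are finite and $\mu$ is the counting measure, (a)–(c) follow from positivity, twice continuous differentiability and compactness.) Let $0<\lambda\le1$. Let the triples $(X^{(i)},Y^{(i)},Z^{(i)})$, $i\ge1$, be independent and identically distributed, where $(X^{(i)},Y^{(i)})$ has density $p_{\theta_0}$ and $Z^{(i)}\sim\mathrm{Bin}(1,\lambda)$ is independent of $(X^{(i)},Y^{(i)})$. Let $$\ell_n(\theta)=\sum_{i=1}^n Z^{(i)}\log p_\theta(X^{(i)},Y^{(i)})+\sum_{i=1}^n(1-Z^{(i)})\log p_\theta(X^{(i)}),$$ and let $\hat\theta_n$ be a (measurable) maximizer of $\ell_n$ over $\Theta$. Put $V_1=\nabla_\theta\log p_{\theta_0}(X,Y)$, $V_2=\nabla_\theta\log p_{\theta_0}(X)$ and $$\Sigma=\lambda\operatorname{Var}_{\theta_0}(V_1)+(1-\lambda)\operatorname{Var}_{\theta_0}(V_2),$$ and assume that $\Sigma$ is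 nonsingular. Then $V_1$ and $V_2$ are square integrable under $P_{\theta_0}$, and $$\sqrt n\,(\hat\theta_n-\theta_0)\ \xrightarrow{\ d\ }\ N(0,\Sigma^{-1})\qquad(n\to\infty).$$ -/

import Mathlib

open MeasureTheory ProbabilityTheory Filter Topology

namespace SemiSup

noncomputable section

/-- The parameter space `ℝ^r` with the Euclidean norm. -/
abbrev Param (r : ℕ) : Type := EuclideanSpace ℝ (Fin r)

/-- The measure with density `f` with respect to the reference measure `m`. -/
def law {S : Type*} [MeasurableSpace S] (m : Measure S) (f : S → ℝ) : Measure S :=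
  m.withDensity fun s => ENNReal.ofReal (f s)

/-- The marginal density `p_θ(x) = ∑_y p_θ(x, y)`. -/
def marginal {r : ℕ} {𝒳 𝒴 : Type*} (p : Param r → 𝒳 × 𝒴 → ℝ) : Param r → 𝒳 → ℝ :=
  fun θ x => ∑' y, p θ (x, y)

/-- The family of densities (with respect to `m`) is identifiable over `Θ`: distinct parameters
have densities whose difference is not zero (almost everywhere, since densities are only
determined up to null sets). -/
def Identifiable {r : ℕ} {S : Type*} [MeasurableSpace S] (m : Measure S)
    (f : Param r → S → ℝ) (Θ : Set (Param r)) : Prop :=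
  ∀ θ ∈ Θ, ∀ η ∈ Θ, θ ≠ η → ¬ (f θ =ᵐ[m] f η)

/-- The score `∇_θ log f_θ(s)`. -/
def score {r : ℕ} {S : Type*} (f : Param r → S → ℝ) (θ : Param r) (s : S) : Param r :=
  gradient (fun η => Real.log (f η s)) θ

/-- The variance matrix of the score at `θ` under the law with density `f_θ`. -/
def scoreVar {r : ℕ} {S : Type*} [MeasurableSpace S] (m : Measure S)
    (f : Param r → S → ℝ) (θ : Param r) : Matrix (Fin r) (Fin r) ℝ :=
  Matrix.of fun i j =>
    covariance (fun s => score f θ s i) (fun s => score f θ s j) (law m (f θ))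

/-- Smoothness in the parameter, together with the classical domination conditions of
maximum-likelihood theory at the true parameter `θ₀`. -/
structure RegularFamily {r : ℕ} {S : Type*} [MeasurableSpace S] (m : Measure S)
    (f : Param r → S → ℝ) (Θ : Set (Param r)) (θ₀ : Param r) : Prop where
  /-- `θ ↦ f_θ(s)` is twice continuously differentiable. -/
  smooth : ∀ s, ContDiffOn ℝ 2 (fun θ => f θ s) Θ
  /-- The log-densities have an integrable envelope. -/
  log_dominated : ∃ K : S → ℝ, Integrable K (law m (f θ₀)) ∧
    ∀ᵐ s ∂m, ∀ θ ∈ Θ, |Real.log (f θ s)| ≤ K s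
  /-- Near `θ₀` the Hessians of the log-densities have an integrable envelope. -/
  logHessian_dominated : ∃ U ∈ 𝓝 θ₀, ∃ K : S → ℝ, Integrable K (law m (f θ₀)) ∧
    ∀ᵐ s ∂m, ∀ θ ∈ U, ‖iteratedFDeriv ℝ 2 (fun η => Real.log (f η s)) θ‖ ≤ K s
  /-- Near `θ₀` the first two derivatives of the densities are dominated by an `m`-integrable
  function, so that `∫ f_θ dm` can be differentiated twice under the integral sign. -/
  deriv_dominated : ∃ U ∈ 𝓝 θ₀, ∃ G : S → ℝ, Integrable G m ∧
    ∀ᵐ s ∂m, ∀ θ ∈ U, ‖fderiv ℝ (fun η => f η s) θ‖ ≤ G s ∧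
      ‖iteratedFDeriv ℝ 2 (fun η => f η s) θ‖ ≤ G s

/-- The law `Bin(1, lam)` of a label indicator. -/
def indicatorLaw (lam : ℝ) : Measure ℝ :=
  ENNReal.ofReal lam • Measure.dirac 1 + ENNReal.ofReal (1 - lam) • Measure.dirac 0

/-- The semi-supervised log-likelihood
`ℓ_n(θ) = ∑_{i<n} Z_i log p_θ(X_i, Y_i) + ∑_{i<n} (1 - Z_i) log p_θ(X_i)` of the data
`(X_i)`, `(Y_i)`, `(Z_i)`. -/
def logLik {r : ℕ} {𝒳 𝒴 : Type*} (p : Param r → 𝒳 × 𝒴 → ℝ)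
    (X : ℕ → 𝒳) (Y : ℕ → 𝒴) (Z : ℕ → ℝ) (n : ℕ) (θ : Param r) : ℝ :=
  ∑ i ∈ Finset.range n, Z i * Real.log (p θ (X i, Y i)) +
    ∑ i ∈ Finset.range n, (1 - Z i) * Real.log (marginal p θ (X i))

/-- `Σ = lam Var(∇ log p_{θ₀}(X, Y)) + (1 - lam) Var(∇ log p_{θ₀}(X))`. -/
def infoMatrix {r : ℕ} {𝒳 𝒴 : Type*} [MeasurableSpace 𝒳] [MeasurableSpace 𝒴]
    (μ : Measure 𝒳) (p : Param r → 𝒳 × 𝒴 → ℝ) (lam : ℝ) (θ₀ : Param r) :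
    Matrix (Fin r) (Fin r) ℝ :=
  lam • scoreVar (μ.prod Measure.count) p θ₀ + (1 - lam) • scoreVar μ (marginal p) θ₀

end

end SemiSup

/-! Each triple `w = ((x, y), z)` is one observation, and `θhat` is the M-estimator for the
criterion `q_θ(w) = z log p_θ(x, y) + (1 - z) log p_θ(x)`. As `z` is 0 or 1 and independent of `(x,
y)`, every expectation of `q_θ` or its derivatives is `lam` times a joint term plus `1 - lam` times
a marginal term.

Consistency: Gibbs' inequality (`integral_log_le_and_ae_eq`) makes `θ₀` the only maximizer of the
mean criterion, and the uniform law of large numbers (`uniform_strong_law`) transfers this to the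
sample maximizers.

Normality: a maximizer near `θ₀` is a zero of the average gradient, and uniform convergence of the
Hessians turns this into one Newton step (`eventually_norm_sub_newton_le`). The central limit
theorem for the gradients and a Slutsky argument give the limit. Differentiating `∫ f_θ = 1` twice
shows that the score has mean zero and that the expected Hessian is minus the score variance, so for
the mixture the Hessian is `-Σ`, the gradient variance is `Σ`, and the sandwich `Σ⁻¹ Σ Σ⁻¹`
collapses to `Σ⁻¹`. Square integrability of the scores falls out of the same computation. -/

namespace SemiSup

set_option maxSynthPendingDepth 3

/-! ### Measurability of parameter derivatives and of random continuous functions. -/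

/-- A continuous-linear-map-valued function on a finite-dimensional space is strongly measurable
if all its evaluations are. -/
theorem stronglyMeasurable_clm_of_apply {S E F : Type*} [MeasurableSpace S]
    [NormedAddCommGroup E] [NormedSpace ℝ E] [FiniteDimensional ℝ E]
    [NormedAddCommGroup F] [NormedSpace ℝ F] {L : S → E →L[ℝ] F}
    (h : ∀ v, StronglyMeasurable fun s => L s v) : StronglyMeasurable L := by
  let b := Module.finBasis ℝ E
  have key : L = fun s => ∑ i, ContinuousLinearMap.smulRightL ℝ E F
      (LinearMap.toContinuousLinearMap (b.coord i)) (L s (b i)) := by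
    funext s
    ext v
    conv_lhs => rw [← b.sum_repr v]
    rw [map_sum]
    simp
  rw [key]
  refine Finset.stronglyMeasurable_fun_sum _ fun i _ => ?_
  exact (ContinuousLinearMap.continuous _).comp_stronglyMeasurable (h _)

/-- The derivative in the parameter of a family of strongly measurable functions is strongly
measurable. -/
theorem stronglyMeasurable_fderiv_param {S E F : Type*} [MeasurableSpace S]
    [NormedAddCommGroup E] [NormedSpace ℝ E] [FiniteDimensional ℝ E]
    [NormedAddCommGroup F] [NormedSpace ℝ F] {f : E → S → F} {θ : E}
    (hf : ∀ᶠ η in 𝓝 θ, StronglyMeasurable (f η))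
    (hd : ∀ s, DifferentiableAt ℝ (fun η => f η s) θ) :
    StronglyMeasurable fun s => fderiv ℝ (fun η => f η s) θ := by
  refine stronglyMeasurable_clm_of_apply fun v => ?_
  have hc : Tendsto (fun n : ℕ => ((n : ℝ) + 1)) atTop atTop :=
    tendsto_atTop_add_const_right _ _ tendsto_natCast_atTop_atTop
  have hstep : Tendsto (fun n : ℕ => θ + ((n : ℝ) + 1)⁻¹ • v) atTop (𝓝 θ) := by
    simpa using tendsto_const_nhds.add ((tendsto_inv_atTop_zero.comp hc).smul_const v)
  -- Difference quotients with step `1/(n + 1)` converge to the derivative; the shift by `N` keeps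
  -- `θ + v/(n + 1)` where `f` is known to be measurable.
  obtain ⟨N, hN⟩ := eventually_atTop.1 (hstep.eventually hf)
  refine stronglyMeasurable_of_tendsto (u := atTop)
    (f := fun (n : ℕ) s => (((n + N : ℕ) : ℝ) + 1) •
      (f (θ + (((n + N : ℕ) : ℝ) + 1)⁻¹ • v) s - f θ s)) (fun n => ?_) ?_
  · exact ((hN _ (Nat.le_add_left _ _)).sub hf.self_of_nhds).const_smul _
  · refine tendsto_pi_nhds.2 fun s => ?_
    have := (hd s).hasFDerivAt.lim v (tendsto_norm_atTop_atTop.comp hc)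
    exact (tendsto_add_atTop_iff_nat N).2 this

/-- A map into a separable space of continuous functions is measurable if all its evaluations
are. -/
theorem measurable_continuousMap_of_eval {S K F : Type*} [MeasurableSpace S]
    [TopologicalSpace K] [CompactSpace K] [TopologicalSpace.SeparableSpace K] [NormedAddCommGroup F]
    [MeasurableSpace F] [BorelSpace F]
    [SecondCountableTopology C(K, F)]
    [MeasurableSpace C(K, F)] [BorelSpace C(K, F)] {g : S → C(K, F)}
    (hg : ∀ k, Measurable fun s => g s k) : Measurable g := by
  -- By continuity a sup-norm bound need only be tested on a countable dense set, so closed balls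
  -- have measurable preimages. Second countability then writes every open set as a countable union
  -- of such balls.
  have hball : ∀ (c : C(K, F)) (ρ : ℝ), 0 ≤ ρ →
      MeasurableSet (g ⁻¹' Metric.closedBall c ρ) := by
    intro c ρ hρ
    obtain ⟨D, hDc, hDd⟩ := TopologicalSpace.exists_countable_dense K
    have : g ⁻¹' Metric.closedBall c ρ =
        ⋂ k ∈ D, (fun s => g s k) ⁻¹' Metric.closedBall (c k) ρ := by
      ext s
      simp only [Set.mem_preimage, Metric.mem_closedBall, Set.mem_iInter]
      rw [ContinuousMap.dist_le hρ]
      refine ⟨fun h k _ => h k, fun h k => ?_⟩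
      have hcl : IsClosed {k | dist (g s k) (c k) ≤ ρ} :=
        isClosed_le ((g s).continuous.dist c.continuous) continuous_const
      have hsub : closure D ⊆ {k | dist (g s k) (c k) ≤ ρ} := hcl.closure_subset_iff.2 h
      exact hsub (hDd k)
    rw [this]
    exact MeasurableSet.biInter hDc fun k _ => hg k Metric.isClosed_closedBall.measurableSet
  refine measurable_of_isOpen fun U hU => ?_
  have hnhds : ∀ c : U, ∃ ρ : ℝ, 0 < ρ ∧ Metric.closedBall (c : C(K, F)) ρ ⊆ U := fun c =>
    Metric.nhds_basis_closedBall.mem_iff.1 (hU.mem_nhds c.2)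
  choose ρ hρ hρU using hnhds
  obtain ⟨T, hTc, hT⟩ := TopologicalSpace.isOpen_iUnion_countable
    (fun c : U => Metric.ball (c : C(K, F)) (ρ c)) fun _ => Metric.isOpen_ball
  have hUeq : U = ⋃ c ∈ T, Metric.closedBall (c : C(K, F)) (ρ c) := by
    refine Set.Subset.antisymm (fun x hx => ?_) (Set.iUnion₂_subset fun c _ => hρU c)
    have : x ∈ ⋃ c ∈ T, Metric.ball (c : C(K, F)) (ρ c) := by
      rw [hT]
      exact Set.mem_iUnion.2 ⟨⟨x, hx⟩, Metric.mem_ball_self (hρ _)⟩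
    exact Set.iUnion₂_mono (fun c _ => Metric.ball_subset_closedBall) this
  rw [hUeq, Set.preimage_iUnion₂]
  exact MeasurableSet.biUnion hTc fun c _ => hball _ _ (hρ c).le

/-! ### Probabilistic limit theorems. -/

/-- **Uniform law of large numbers** over a compact parameter set. -/
theorem uniform_strong_law {Ω S E F : Type*} [MeasurableSpace Ω] [MeasurableSpace S]
    {P : Measure Ω} {ν : Measure S}
    [PseudoMetricSpace E]
    [NormedAddCommGroup F] [NormedSpace ℝ F] [CompleteSpace F] [SecondCountableTopology F]
    {W : ℕ → Ω → S} (hindep : iIndepFun W P) (hlaw : ∀ i, HasLaw (W i) ν P)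
    {K : Set E} (hK : IsCompact K) {g : E → S → F}
    (hmeas : ∀ θ ∈ K, StronglyMeasurable (g θ))
    (hcont : ∀ s, ContinuousOn (fun θ => g θ s) K)
    {H : S → ℝ} (hH : Integrable H ν) (hbound : ∀ᵐ s ∂ν, ∀ θ ∈ K, ‖g θ s‖ ≤ H s) :
    ContinuousOn (fun θ => ∫ s, g θ s ∂ν) K ∧
    ∀ᵐ ω ∂P, TendstoUniformlyOn
      (fun (n : ℕ) θ => (n : ℝ)⁻¹ • ∑ i ∈ Finset.range n, g θ (W i ω))
      (fun θ => ∫ s, g θ s ∂ν) atTop K := by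
  have : CompactSpace K := isCompact_iff_compactSpace.1 hK
  borelize F
  borelize C(K, F)
  -- The whole path `θ ↦ g θ s` is one random element of the Banach space `C(K, F)`, with norm
  -- dominated by `H`. The strong law in that space is convergence in sup norm, and continuity of
  -- the mean comes with it.
  let G : S → C(K, F) := fun s => ⟨fun θ => g θ s, (hcont s).domRestrict⟩
  have hGmeas : Measurable G :=
    measurable_continuousMap_of_eval fun k => (hmeas k k.2).measurable
  have hGint : Integrable G ν := by
    refine Integrable.mono' hH.norm hGmeas.aestronglyMeasurable ?_
    filter_upwards [hbound] with s hs
    exact (ContinuousMap.norm_le _ (norm_nonneg _)).2 fun k =>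
      (hs k k.2).trans (Real.le_norm_self _)
  have hGint' : Integrable G (P.map (W 0)) := by rwa [(hlaw 0).map_eq]
  have hslln := strong_law_ae (μ := P) (fun i ω => G (W i ω))
    (hGint'.comp_aemeasurable (hlaw 0).aemeasurable)
    (fun i j hij => (hindep.indepFun hij).comp hGmeas hGmeas)
    (fun i => (IdentDistrib.mk (hlaw i).aemeasurable (hlaw 0).aemeasurable
      ((hlaw i).map_eq.trans (hlaw 0).map_eq.symm)).comp hGmeas)
  have hmean : ∫ ω, G (W 0 ω) ∂P = ∫ s, G s ∂ν :=
    (hlaw 0).integral_comp hGmeas.aestronglyMeasurable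
  have hval : ∀ k : K, (∫ s, G s ∂ν) k = ∫ s, g k s ∂ν := fun k =>
    ((ContinuousMap.evalCLM ℝ k).integral_comp_comm hGint).symm
  constructor
  · rw [continuousOn_iff_continuous_domRestrict]
    have : K.domRestrict (fun θ => ∫ s, g θ s ∂ν) = ⇑(∫ s, G s ∂ν) := by
      funext k
      exact (hval k).symm
    rw [this]
    exact ContinuousMap.continuous _
  · filter_upwards [hslln] with ω hω
    rw [hmean] at hω
    rw [tendstoUniformlyOn_iff_tendstoUniformly_comp_coe]
    have h1 := ContinuousMap.tendsto_iff_tendstoUniformly.1 hω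
    have h2 : (fun θ => ∫ s, g θ s ∂ν) ∘ ((↑) : K → E) = ⇑(∫ s, G s ∂ν) := by
      funext k
      exact (hval k).symm
    rw [h2]
    convert h1 using 3 with n k
    simp only [ContinuousMap.smul_apply, ContinuousMap.sum_apply]
    rfl

/-- **Multivariate central limit theorem** for centered square-integrable vectors. -/
theorem tendstoInDistribution_inv_sqrt_smul_sum {Ω ι : Type*} [Fintype ι] [DecidableEq ι]
    [MeasurableSpace Ω] {P : Measure Ω} [IsProbabilityMeasure P]
    {V : ℕ → Ω → EuclideanSpace ℝ ι} (hindep : iIndepFun V P)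
    (hident : ∀ i, IdentDistrib (V i) (V 0) P P)
    (hL2 : MemLp (V 0) 2 P) (hmean : ∫ ω, V 0 ω ∂P = 0)
    {C : Matrix ι ι ℝ} (hC : C.PosSemidef)
    (hcov : ∀ u : EuclideanSpace ℝ ι, ∫ ω, (inner ℝ u (V 0 ω)) ^ 2 ∂P = u ⬝ᵥ C.mulVec u) :
    TendstoInDistribution (fun (n : ℕ) ω => (√(n : ℝ))⁻¹ • ∑ i ∈ Finset.range n, V i ω) atTop id
      (fun _ => P) (multivariateGaussian 0 C) := by
  have hVm : ∀ i, AEMeasurable (V i) P := fun i => (hident i).aemeasurable_fst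
  have hSm : ∀ n : ℕ, AEMeasurable
      (fun ω => (√(n : ℝ))⁻¹ • ∑ i ∈ Finset.range n, V i ω) P := fun n =>
    (Finset.aemeasurable_fun_sum _ fun i _ => hVm i).fun_const_smul _
  refine ⟨hSm, aemeasurable_id, ?_⟩
  refine ProbabilityMeasure.tendsto_iff_tendsto_charFun.2 fun u => ?_
  have hint : Integrable (V 0) P := hL2.integrable one_le_two
  have hX2 : MemLp (fun ω => inner ℝ u (V 0 ω)) 2 P := hL2.const_inner u
  have hX0 : ∫ ω, inner ℝ u (V 0 ω) ∂P = 0 := by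
    rw [integral_inner hint, hmean, inner_zero_right]
  have hvar : Var[fun ω => inner ℝ u (V 0 ω); P] = u ⬝ᵥ C.mulVec u := by
    rw [variance_of_integral_eq_zero hX2.aemeasurable hX0]
    exact hcov u
  have hvar_nonneg : 0 ≤ u ⬝ᵥ C.mulVec u := hvar ▸ variance_nonneg _ _
  have hclt := tendstoInDistribution_inv_sqrt_mul_sum_sub (P := P)
    (X := fun i ω => inner ℝ u (V i ω)) (Y := id)
    (P' := gaussianReal 0 Var[fun ω => inner ℝ u (V 0 ω); P].toNNReal)
    HasLaw.id hX2
    (hindep.comp (fun _ v => inner ℝ u v) fun _ => by fun_prop)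
    (fun i => (hident i).comp (u := fun v => inner ℝ u v) (by fun_prop))
  -- Cramér–Wold: the characteristic function of the vector sum at `u` is that of the scalar sum of
  -- the `inner ℝ u (V i)` at `1`.
  have h1 := ProbabilityMeasure.tendsto_iff_tendsto_charFun.1 hclt.tendsto 1
  simp only [ProbabilityMeasure.coe_mk, Measure.map_id] at h1 ⊢
  convert h1 using 1
  · funext n
    rw [charFun_apply, charFun_apply, integral_map (hSm n) (by fun_prop),
      integral_map (hclt.forall_aemeasurable n) (by fun_prop)]
    refine integral_congr_ae (Eventually.of_forall fun ω => ?_)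
    simp only [hX0, mul_zero, sub_zero]
    congr 3
    simp [inner_smul_left, sum_inner, real_inner_comm]
  · rw [charFun_multivariateGaussian hC, charFun_gaussianReal, hvar,
      Real.coe_toNNReal _ hvar_nonneg]
    simp

/-! ### Deterministic core: convergence of maximizers and the Newton step. -/

/-- Maximizers of uniformly converging criteria on a compact set converge to the unique maximizer
of the limit. -/
theorem tendsto_of_isMaxOn_of_tendstoUniformlyOn {E : Type*} [TopologicalSpace E]
    {K : Set E} (hK : IsCompact K) {θ₀ : E} (hθ₀ : θ₀ ∈ K)
    {M : ℕ → E → ℝ} {m : E → ℝ} (hm : ContinuousOn m K)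
    (hM : TendstoUniformlyOn M m atTop K) (hmax : ∀ θ ∈ K, θ ≠ θ₀ → m θ < m θ₀)
    {t : ℕ → E} (htK : ∀ n, t n ∈ K) (ht : ∀ n, IsMaxOn (M n) K (t n)) :
    Tendsto t atTop (𝓝 θ₀) := by
  rw [tendsto_nhds]
  intro U hU hθ₀U
  rcases (K \ U).eq_empty_or_nonempty with hemp | hne
  · exact Eventually.of_forall fun n => Set.sdiff_eq_empty.1 hemp (htK n)
  · obtain ⟨η, hη, hηmax⟩ := (hK.diff hU).exists_isMaxOn hne (hm.mono Set.sdiff_subset)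
    -- `η` is the best point outside `U`. Errors below half the gap at both `t n` and `θ₀` would
    -- force `M n (t n) < M n θ₀` if `t n` lay outside `U`.
    have hgap : 0 < (m θ₀ - m η) / 2 := by
      have := hmax η hη.1 fun h => hη.2 (h ▸ hθ₀U)
      linarith
    filter_upwards [Metric.tendstoUniformlyOn_iff.1 hM _ hgap] with n hn
    by_contra hnU
    have h1 : m (t n) ≤ m η := hηmax ⟨htK n, hnU⟩
    have h2 : M n θ₀ ≤ M n (t n) := ht n hθ₀
    have h3 := abs_lt.1 (Real.dist_eq _ _ ▸ hn _ (htK n))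
    have h4 := abs_lt.1 (Real.dist_eq _ _ ▸ hn _ hθ₀)
    linarith [h3.1, h3.2, h4.1, h4.2]

/-- Asymptotic linearity: zeros of functions whose derivatives converge uniformly near the limit
point are approximated, up to a relative error tending to zero, by one Newton step. -/
theorem eventually_norm_sub_newton_le {E F : Type*} [NormedAddCommGroup E] [NormedSpace ℝ E]
    [NormedAddCommGroup F] [NormedSpace ℝ F] {θ₀ : E} {δ : ℝ} (hδ : 0 < δ)
    {D : ℕ → E → F} {D' : ℕ → E → E →L[ℝ] F} {L : E → E →L[ℝ] F}
    (hD : ∀ n, ∀ θ ∈ Metric.closedBall θ₀ δ, HasFDerivAt (D n) (D' n θ) θ)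
    (hL : ContinuousOn L (Metric.closedBall θ₀ δ))
    (hunif : TendstoUniformlyOn D' L atTop (Metric.closedBall θ₀ δ))
    {t : ℕ → E} (ht : Tendsto t atTop (𝓝 θ₀)) (hzero : ∀ᶠ n in atTop, D n (t n) = 0)
    (J : F →L[ℝ] E) (hJ : ∀ u, J (L θ₀ u) = -u) {ε : ℝ} (hε : 0 < ε) :
    ∀ᶠ n in atTop, ‖t n - θ₀ - J (D n θ₀)‖ ≤ ε * ‖J (D n θ₀)‖ := by
  -- `a ≤ 1/2` lets `‖d‖ ≤ a ‖d‖ + ‖w‖` be solved as `‖d‖ ≤ 2 ‖w‖`, and `a ≤ ε/2` then gives the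
  -- relative error `ε`. Below, `b` absorbs `‖J‖` and the two errors of `hderiv`; the `+ 1` covers
  -- `J = 0`.
  set a : ℝ := min (ε / 2) (1 / 2) with ha_def
  have ha : 0 < a := lt_min (by positivity) (by norm_num)
  have haε : a ≤ ε / 2 := min_le_left _ _
  have ha2 : a ≤ 1 / 2 := min_le_right _ _
  set b : ℝ := a / (2 * (‖J‖ + 1)) with hb_def
  have hJ1 : 0 < ‖J‖ + 1 := by positivity
  have hb : 0 < b := by positivity
  have hθ₀ : θ₀ ∈ Metric.closedBall θ₀ δ := Metric.mem_closedBall_self hδ.le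
  obtain ⟨ρ, hρ, hρL⟩ := Metric.continuousOn_iff.1 hL θ₀ hθ₀ b hb
  filter_upwards [Metric.tendstoUniformlyOn_iff.1 hunif b hb, hzero,
    ht (Metric.ball_mem_nhds θ₀ (lt_min hρ hδ))] with n hn hz htn
  set σ := min ρ δ
  have hsub : Metric.ball θ₀ σ ⊆ Metric.closedBall θ₀ δ :=
    (Metric.ball_subset_ball (min_le_right _ _)).trans Metric.ball_subset_closedBall
  have hderiv : ∀ θ ∈ Metric.ball θ₀ σ, ‖D' n θ - L θ₀‖ ≤ 2 * b := by
    intro θ hθ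
    have h1 := hn θ (hsub hθ)
    have h2 := hρL θ (hsub hθ) (Metric.ball_subset_ball (min_le_left _ _) hθ)
    rw [← dist_eq_norm]
    calc dist (D' n θ) (L θ₀) ≤ dist (D' n θ) (L θ) + dist (L θ) (L θ₀) := dist_triangle _ _ _
      _ ≤ b + b := add_le_add (by rw [dist_comm]; exact h1.le) h2.le
      _ = 2 * b := by ring
  -- Mean value inequality for `D n - L θ₀`, whose derivative is at most `2 * b` on the ball; this
  -- also works for vector-valued `D n`, where no exact mean value point exists.
  have hmv := (convex_ball θ₀ σ).norm_image_sub_le_of_norm_hasFDerivWithin_le'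
    (fun θ hθ => (hD n θ (hsub hθ)).hasFDerivWithinAt) hderiv
    (Metric.mem_ball_self (lt_min hρ hδ)) htn
  rw [hz] at hmv
  set d := t n - θ₀
  set w := J (D n θ₀)
  have h1 : d - w = J (0 - D n θ₀ - L θ₀ d) := by
    rw [map_sub, map_sub, hJ, map_zero]
    simp only [w]
    abel
  have h2 : ‖d - w‖ ≤ a * ‖d‖ := by
    rw [h1]
    calc ‖J (0 - D n θ₀ - L θ₀ d)‖ ≤ ‖J‖ * (2 * b * ‖d‖) :=
          (J.le_opNorm _).trans (mul_le_mul_of_nonneg_left hmv (norm_nonneg _))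
      _ ≤ (‖J‖ + 1) * (2 * b * ‖d‖) := by gcongr; linarith
      _ = a * ‖d‖ := by rw [hb_def]; field_simp
  have h3 : ‖d‖ ≤ ‖d - w‖ + ‖w‖ := by simpa using norm_add_le (d - w) w
  have h4 : ‖d‖ ≤ 2 * ‖w‖ := by nlinarith [norm_nonneg d]
  calc ‖d - w‖ ≤ a * ‖d‖ := h2
    _ ≤ ε / 2 * (2 * ‖w‖) := by gcongr
    _ = ε * ‖w‖ := by ring

/-! ### M-estimators: asymptotic linearity and normality. -/

/-- Regularity at interior points of a function that is `C²` on a set. -/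
theorem contDiffOn_fderiv_interior {E : Type*} [NormedAddCommGroup E] [NormedSpace ℝ E]
    {f : E → ℝ} {Θ : Set E} (hf : ContDiffOn ℝ 2 f Θ) :
    ContDiffOn ℝ 1 (fderiv ℝ f) (interior Θ) :=
  (hf.mono interior_subset).fderiv_of_isOpen isOpen_interior (by norm_num)

theorem continuousOn_fderiv_fderiv_interior {E : Type*} [NormedAddCommGroup E] [NormedSpace ℝ E]
    {f : E → ℝ} {Θ : Set E} (hf : ContDiffOn ℝ 2 f Θ) :
    ContinuousOn (fderiv ℝ (fderiv ℝ f)) (interior Θ) :=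
  (contDiffOn_fderiv_interior hf).continuousOn_fderiv_of_isOpen isOpen_interior le_rfl

theorem differentiableAt_of_mem_interior {E : Type*} [NormedAddCommGroup E] [NormedSpace ℝ E]
    {f : E → ℝ} {Θ : Set E} (hf : ContDiffOn ℝ 2 f Θ) {θ : E} (hθ : θ ∈ interior Θ) :
    DifferentiableAt ℝ f θ :=
  (hf.contDiffAt (mem_interior_iff_mem_nhds.1 hθ)).differentiableAt (by norm_num)

theorem differentiableAt_fderiv_of_mem_interior {E : Type*} [NormedAddCommGroup E]
    [NormedSpace ℝ E] {f : E → ℝ} {Θ : Set E} (hf : ContDiffOn ℝ 2 f Θ) {θ : E}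
    (hθ : θ ∈ interior Θ) : DifferentiableAt ℝ (fderiv ℝ f) θ :=
  ((contDiffOn_fderiv_interior hf).contDiffAt (isOpen_interior.mem_nhds hθ)).differentiableAt
    (by norm_num)

theorem stronglyMeasurable_fderiv_of_mem_interior {S E : Type*} [MeasurableSpace S]
    [NormedAddCommGroup E] [NormedSpace ℝ E] [FiniteDimensional ℝ E] {q : E → S → ℝ}
    {Θ : Set E} (hmeas : ∀ θ ∈ Θ, Measurable (q θ))
    (hsmooth : ∀ s, ContDiffOn ℝ 2 (fun θ => q θ s) Θ) {θ : E} (hθ : θ ∈ interior Θ) :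
    StronglyMeasurable fun s => fderiv ℝ (fun η => q η s) θ := by
  refine stronglyMeasurable_fderiv_param ?_ fun s =>
    differentiableAt_of_mem_interior (hsmooth s) hθ
  filter_upwards [mem_interior_iff_mem_nhds.1 hθ] with η hη
  exact (hmeas η hη).stronglyMeasurable

theorem stronglyMeasurable_fderiv_fderiv_of_mem_interior {S E : Type*} [MeasurableSpace S]
    [NormedAddCommGroup E] [NormedSpace ℝ E] [FiniteDimensional ℝ E] {q : E → S → ℝ}
    {Θ : Set E} (hmeas : ∀ θ ∈ Θ, Measurable (q θ))
    (hsmooth : ∀ s, ContDiffOn ℝ 2 (fun θ => q θ s) Θ) {θ : E} (hθ : θ ∈ interior Θ) :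
    StronglyMeasurable fun s => fderiv ℝ (fderiv ℝ fun η => q η s) θ := by
  refine stronglyMeasurable_fderiv_param (f := fun η s => fderiv ℝ (fun η => q η s) η) ?_
    fun s => differentiableAt_fderiv_of_mem_interior (hsmooth s) hθ
  filter_upwards [isOpen_interior.mem_nhds hθ] with η hη
  exact stronglyMeasurable_fderiv_of_mem_interior hmeas hsmooth hη

/-- Almost surely, an M-estimator is asymptotically linear: its error differs from the average of
the influence function `s ↦ J (∇ q_{θ₀}(s))` by a relatively negligible amount. -/
theorem ae_eventually_mEstimator_linear {Ω S E : Type*} [MeasurableSpace Ω] [MeasurableSpace S]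
    [NormedAddCommGroup E] [NormedSpace ℝ E] [FiniteDimensional ℝ E]
    {P : Measure Ω} {ν : Measure S}
    {W : ℕ → Ω → S} (hindep : iIndepFun W P) (hlaw : ∀ i, HasLaw (W i) ν P)
    {Θ : Set E} (hΘ : IsCompact Θ) {θ₀ : E} (hθ₀ : θ₀ ∈ interior Θ)
    {q : E → S → ℝ} (hmeas : ∀ θ ∈ Θ, Measurable (q θ))
    (hsmooth : ∀ s, ContDiffOn ℝ 2 (fun θ => q θ s) Θ)
    {K : S → ℝ} (hK : Integrable K ν) (hqK : ∀ᵐ s ∂ν, ∀ θ ∈ Θ, |q θ s| ≤ K s)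
    (hmax : ∀ θ ∈ Θ, θ ≠ θ₀ → ∫ s, q θ s ∂ν < ∫ s, q θ₀ s ∂ν)
    {U : Set E} (hU : U ∈ 𝓝 θ₀) {H : S → ℝ} (hH : Integrable H ν)
    (hqH : ∀ᵐ s ∂ν, ∀ θ ∈ U, ‖fderiv ℝ (fderiv ℝ fun η => q η s) θ‖ ≤ H s)
    {J : (E →L[ℝ] ℝ) →L[ℝ] E}
    (hJ : ∀ u, J ((∫ s, fderiv ℝ (fderiv ℝ fun η => q η s) θ₀ ∂ν) u) = -u)
    {t : ℕ → Ω → E}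
    (ht : ∀ n, ∀ᵐ ω ∂P, t n ω ∈ Θ ∧
      IsMaxOn (fun θ => ∑ i ∈ Finset.range n, q θ (W i ω)) Θ (t n ω)) :
    ∀ᵐ ω ∂P, ∀ ε > 0, ∀ᶠ n : ℕ in atTop,
      ‖t n ω - θ₀ - (n : ℝ)⁻¹ • ∑ i ∈ Finset.range n, J (fderiv ℝ (fun η => q η (W i ω)) θ₀)‖ ≤
        ε * ‖(n : ℝ)⁻¹ • ∑ i ∈ Finset.range n, J (fderiv ℝ (fun η => q η (W i ω)) θ₀)‖ := by
  obtain ⟨δ, hδ, hball⟩ := Metric.nhds_basis_closedBall.mem_iff.1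
    (inter_mem hU (isOpen_interior.mem_nhds hθ₀))
  have hballU : Metric.closedBall θ₀ δ ⊆ U := hball.trans Set.inter_subset_left
  have hballΘ : Metric.closedBall θ₀ δ ⊆ interior Θ := hball.trans Set.inter_subset_right
  have : ProperSpace E := FiniteDimensional.proper ℝ E
  obtain ⟨hMcont, hMunif⟩ := uniform_strong_law hindep hlaw hΘ
    (fun θ hθ => (hmeas θ hθ).stronglyMeasurable) (fun s => (hsmooth s).continuousOn) hK hqK
  obtain ⟨hLcont, hLunif⟩ := uniform_strong_law hindep hlaw (isCompact_closedBall θ₀ δ)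
    (g := fun θ s => fderiv ℝ (fderiv ℝ fun η => q η s) θ)
    (fun θ hθ => stronglyMeasurable_fderiv_fderiv_of_mem_interior hmeas hsmooth (hballΘ hθ))
    (fun s => (continuousOn_fderiv_fderiv_interior (hsmooth s)).mono hballΘ) hH
    (hqH.mono fun s hs θ hθ => hs θ (hballU hθ))
  filter_upwards [hMunif, hLunif, ae_all_iff.2 ht] with ω hM hL hω
  have hmaxn : ∀ n : ℕ, IsMaxOn
      (fun θ => (n : ℝ)⁻¹ • ∑ i ∈ Finset.range n, q θ (W i ω)) Θ (t n ω) := fun n =>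
    (hω n).2.comp_mono (g := fun x : ℝ => (n : ℝ)⁻¹ • x) fun x y hxy =>
      mul_le_mul_of_nonneg_left hxy (inv_nonneg.2 n.cast_nonneg)
  have hcons : Tendsto (fun n => t n ω) atTop (𝓝 θ₀) :=
    tendsto_of_isMaxOn_of_tendstoUniformlyOn hΘ (interior_subset hθ₀) hMcont hM hmax
      (fun n => (hω n).1) hmaxn
  -- Consistency puts the maximizer in the interior eventually, where it is a local maximum and
  -- Fermat's rule applies.
  have hzero : ∀ᶠ n : ℕ in atTop,
      (n : ℝ)⁻¹ • ∑ i ∈ Finset.range n, fderiv ℝ (fun η => q η (W i ω)) (t n ω) = 0 := by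
    filter_upwards [hcons (isOpen_interior.mem_nhds hθ₀)] with n hn
    have hloc : IsLocalMax (fun θ => (n : ℝ)⁻¹ • ∑ i ∈ Finset.range n, q θ (W i ω)) (t n ω) :=
      (hmaxn n).isLocalMax (mem_interior_iff_mem_nhds.1 hn)
    refine hloc.hasFDerivAt_eq_zero
      (HasFDerivAt.fun_const_smul (HasFDerivAt.fun_sum fun i _ => ?_) _)
    exact (differentiableAt_of_mem_interior (hsmooth _) hn).hasFDerivAt
  intro ε hε
  have key := eventually_norm_sub_newton_le hδ
    (D := fun (n : ℕ) θ => (n : ℝ)⁻¹ • ∑ i ∈ Finset.range n, fderiv ℝ (fun η => q η (W i ω)) θ)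
    (fun n θ hθ => HasFDerivAt.fun_const_smul (HasFDerivAt.fun_sum fun i _ =>
      (differentiableAt_fderiv_of_mem_interior (hsmooth (W i ω)) (hballΘ hθ)).hasFDerivAt) _)
    hLcont hL hcons hzero J hJ hε
  simpa only [map_smul, map_sum] using key

/-- **Asymptotic normality of M-estimators** with influence function `s ↦ J (∇ q_{θ₀}(s))`. -/
theorem mEstimator_tendstoInDistribution {Ω S ι : Type*} [MeasurableSpace Ω] [MeasurableSpace S]
    [Fintype ι] [DecidableEq ι]
    {P : Measure Ω} [IsProbabilityMeasure P] {ν : Measure S}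
    {W : ℕ → Ω → S} (hindep : iIndepFun W P) (hlaw : ∀ i, HasLaw (W i) ν P)
    {Θ : Set (EuclideanSpace ℝ ι)} (hΘ : IsCompact Θ) {θ₀ : EuclideanSpace ℝ ι}
    (hθ₀ : θ₀ ∈ interior Θ)
    {q : EuclideanSpace ℝ ι → S → ℝ} (hmeas : ∀ θ ∈ Θ, Measurable (q θ))
    (hsmooth : ∀ s, ContDiffOn ℝ 2 (fun θ => q θ s) Θ)
    {K : S → ℝ} (hK : Integrable K ν) (hqK : ∀ᵐ s ∂ν, ∀ θ ∈ Θ, |q θ s| ≤ K s)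
    (hmax : ∀ θ ∈ Θ, θ ≠ θ₀ → ∫ s, q θ s ∂ν < ∫ s, q θ₀ s ∂ν)
    {U : Set (EuclideanSpace ℝ ι)} (hU : U ∈ 𝓝 θ₀) {H : S → ℝ} (hH : Integrable H ν)
    (hqH : ∀ᵐ s ∂ν, ∀ θ ∈ U, ‖fderiv ℝ (fderiv ℝ fun η => q η s) θ‖ ≤ H s)
    {J : (EuclideanSpace ℝ ι →L[ℝ] ℝ) →L[ℝ] EuclideanSpace ℝ ι}
    (hJ : ∀ u, J ((∫ s, fderiv ℝ (fderiv ℝ fun η => q η s) θ₀ ∂ν) u) = -u)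
    (hL2 : MemLp (fun s => J (fderiv ℝ (fun η => q η s) θ₀)) 2 ν)
    (hmean : ∫ s, J (fderiv ℝ (fun η => q η s) θ₀) ∂ν = 0)
    {C : Matrix ι ι ℝ} (hC : C.PosSemidef)
    (hcov : ∀ u : EuclideanSpace ℝ ι,
      ∫ s, (inner ℝ u (J (fderiv ℝ (fun η => q η s) θ₀))) ^ 2 ∂ν = u ⬝ᵥ C.mulVec u)
    {t : ℕ → Ω → EuclideanSpace ℝ ι} (htm : ∀ n, AEMeasurable (t n) P)
    (ht : ∀ n, ∀ᵐ ω ∂P, t n ω ∈ Θ ∧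
      IsMaxOn (fun θ => ∑ i ∈ Finset.range n, q θ (W i ω)) Θ (t n ω)) :
    TendstoInDistribution (fun (n : ℕ) ω => √(n : ℝ) • (t n ω - θ₀)) atTop id
      (fun _ => P) (multivariateGaussian 0 C) := by
  set ψ : S → EuclideanSpace ℝ ι := fun s => J (fderiv ℝ (fun η => q η s) θ₀) with hψ
  have hψm : Measurable ψ := (J.continuous.comp_stronglyMeasurable
    (stronglyMeasurable_fderiv_of_mem_interior hmeas hsmooth hθ₀)).measurable
  have hL2' : MemLp ψ 2 (P.map (W 0)) := by rwa [(hlaw 0).map_eq]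
  have hclt := tendstoInDistribution_inv_sqrt_smul_sum (V := fun i ω => ψ (W i ω))
    (hindep.comp (fun _ => ψ) fun _ => hψm)
    (fun i => (IdentDistrib.mk (hlaw i).aemeasurable (hlaw 0).aemeasurable
      ((hlaw i).map_eq.trans (hlaw 0).map_eq.symm)).comp hψm)
    (hL2'.comp_of_map (hlaw 0).aemeasurable)
    (((hlaw 0).integral_comp hψm.aestronglyMeasurable).trans hmean) hC
    (fun u => ((hlaw 0).integral_comp (f := fun s => (inner ℝ u (ψ s)) ^ 2)
      ((measurable_const.inner hψm).pow_const 2).aestronglyMeasurable).trans (hcov u))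
  set Sn : ℕ → Ω → EuclideanSpace ℝ ι :=
    fun n ω => (√(n : ℝ))⁻¹ • ∑ i ∈ Finset.range n, ψ (W i ω) with hSn
  set T : ℕ → Ω → EuclideanSpace ℝ ι := fun n ω => √(n : ℝ) • (t n ω - θ₀) with hT
  have hSm : ∀ n, AEMeasurable (Sn n) P := hclt.forall_aemeasurable
  have hTm : ∀ n, AEMeasurable (T n) P := fun n => ((htm n).sub_const θ₀).fun_const_smul _
  -- The remainder `T n - Sn n` is small only relative to `‖Sn n‖`. Dividing by `‖Sn n‖ + 1` makes
  -- it tend to zero almost surely without a separate tightness argument.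
  set R : ℕ → Ω → EuclideanSpace ℝ ι := fun n ω => (‖Sn n ω‖ + 1)⁻¹ • (T n ω - Sn n ω) with hR
  have hRm : ∀ n, AEMeasurable (R n) P := fun n =>
    ((hSm n).norm.add_const 1).inv.smul ((hTm n).sub (hSm n))
  have hRlim : ∀ᵐ ω ∂P, Tendsto (fun n => R n ω) atTop (𝓝 0) := by
    filter_upwards [ae_eventually_mEstimator_linear hindep hlaw hΘ hθ₀ hmeas hsmooth hK hqK hmax
      hU hH hqH hJ ht] with ω hω
    refine Metric.tendsto_nhds.2 fun ε hε => ?_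
    filter_upwards [hω (ε / 2) (by positivity), eventually_gt_atTop 0] with n hn hn0
    have hn0' : (0 : ℝ) < n := by exact_mod_cast hn0
    have hsq : √(n : ℝ) * (n : ℝ)⁻¹ = (√(n : ℝ))⁻¹ := by
      rw [← Real.sqrt_div_self, div_eq_mul_inv]
    have hS' : √(n : ℝ) • ((n : ℝ)⁻¹ • ∑ i ∈ Finset.range n, ψ (W i ω)) = Sn n ω := by
      rw [smul_smul, hsq]
    have hdiff : ‖T n ω - Sn n ω‖ ≤ ε / 2 * ‖Sn n ω‖ := by
      rw [← hS', hT, ← smul_sub, norm_smul, norm_smul]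
      calc _ ≤ ‖√(n : ℝ)‖ * (ε / 2 * _) := mul_le_mul_of_nonneg_left hn (norm_nonneg _)
        _ = _ := by ring
    rw [dist_zero_right, hR, norm_smul, norm_inv, Real.norm_of_nonneg (by positivity),
      inv_mul_lt_iff₀ (by positivity)]
    nlinarith [norm_nonneg (Sn n ω)]
  -- Slutsky: `T n` is recovered from `(Sn n, R n)` by the continuous map `g`, and `g (z, 0) = z`.
  have hfinal := hclt.continuous_comp_prodMk_of_tendstoInMeasure_const
    (g := fun z : EuclideanSpace ℝ ι × EuclideanSpace ℝ ι => z.1 + (‖z.1‖ + 1) • z.2)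
    (by fun_prop) (tendstoInMeasure_of_tendsto_ae (fun n => (hRm n).aestronglyMeasurable) hRlim)
    hRm
  refine hfinal.congr (fun n => ae_of_all _ fun ω => ?_) (ae_of_all _ fun z => by simp)
  have hpos : ‖Sn n ω‖ + 1 ≠ 0 := by positivity
  change Sn n ω + (‖Sn n ω‖ + 1) • ((‖Sn n ω‖ + 1)⁻¹ • (T n ω - Sn n ω)) = T n ω
  rw [smul_inv_smul₀ hpos]
  abel

/-! ### Integration against a density. -/

section Law

variable {S : Type*} [MeasurableSpace S] {m : Measure S} {f : S → ℝ}

theorem integrable_law_iff {F : Type*} [NormedAddCommGroup F] [NormedSpace ℝ F]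
    (hf : Measurable f) (hpos : ∀ s, 0 < f s) {g : S → F} :
    Integrable g (law m f) ↔ Integrable (fun s => f s • g s) m := by
  rw [law, integrable_withDensity_iff_integrable_smul' hf.ennreal_ofReal
    (ae_of_all _ fun _ => ENNReal.ofReal_lt_top)]
  simp only [ENNReal.toReal_ofReal (hpos _).le]

theorem integral_law {F : Type*} [NormedAddCommGroup F] [NormedSpace ℝ F]
    (hf : Measurable f) (hpos : ∀ s, 0 < f s) (g : S → F) :
    ∫ s, g s ∂(law m f) = ∫ s, f s • g s ∂m := by
  rw [law, integral_withDensity_eq_integral_toReal_smul hf.ennreal_ofReal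
    (ae_of_all _ fun _ => ENNReal.ofReal_lt_top)]
  simp only [ENNReal.toReal_ofReal (hpos _).le]

theorem ae_law_iff (hf : Measurable f) (hpos : ∀ s, 0 < f s) {p : S → Prop} :
    (∀ᵐ s ∂(law m f), p s) ↔ ∀ᵐ s ∂m, p s := by
  rw [law, ae_withDensity_iff hf.ennreal_ofReal]
  simp [hpos]

theorem integrable_density (hf : Measurable f) (hpos : ∀ s, 0 < f s)
    [IsProbabilityMeasure (law m f)] : Integrable f m := by
  simpa using (integrable_law_iff (m := m) hf hpos).1 (integrable_const (1 : ℝ))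

theorem integral_density (hf : Measurable f) (hpos : ∀ s, 0 < f s)
    [IsProbabilityMeasure (law m f)] : ∫ s, f s ∂m = 1 := by
  simpa using (integral_law (m := m) hf hpos fun _ => (1 : ℝ)).symm

end Law

/-! ### Score, information identity and score variance. -/

theorem norm_fderiv_fderiv_eq {E F : Type*} [NormedAddCommGroup E] [NormedSpace ℝ E]
    [NormedAddCommGroup F] [NormedSpace ℝ F] (f : E → F) (x : E) :
    ‖fderiv ℝ (fderiv ℝ f) x‖ = ‖iteratedFDeriv ℝ 2 f x‖ := by
  rw [← norm_iteratedFDeriv_one, norm_iteratedFDeriv_fderiv]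

/-- If the integrals of a family of functions do not depend on the parameter, the integral of the
derivative in the parameter vanishes. -/
theorem integral_fderiv_eq_zero {S E F : Type*} [MeasurableSpace S] {m : Measure S}
    [NormedAddCommGroup E] [NormedSpace ℝ E]
    [NormedAddCommGroup F] [NormedSpace ℝ F] {g : E → S → F} {θ : E}
    {U : Set E} (hU : U ∈ 𝓝 θ) {c : F} (hconst : ∀ η ∈ U, ∫ s, g η s ∂m = c)
    (hmeas : ∀ η ∈ U, AEStronglyMeasurable (g η) m) (hint : Integrable (g θ) m)
    (hmeas' : AEStronglyMeasurable (fun s => fderiv ℝ (fun η => g η s) θ) m)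
    {G : S → ℝ} (hG : Integrable G m)
    (hbound : ∀ᵐ s ∂m, ∀ η ∈ U, ‖fderiv ℝ (fun η => g η s) η‖ ≤ G s)
    (hdiff : ∀ s, ∀ η ∈ U, DifferentiableAt ℝ (fun η => g η s) η) :
    ∫ s, fderiv ℝ (fun η => g η s) θ ∂m = 0 := by
  have h1 := hasFDerivAt_integral_of_dominated_of_fderiv_le hU
    (F' := fun η s => fderiv ℝ (fun η => g η s) η)
    (by filter_upwards [hU] with η hη using hmeas η hη) hint hmeas' hbound hG
    (ae_of_all _ fun s η hη => (hdiff s η hη).hasFDerivAt)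
  have h2 : HasFDerivAt (fun η => ∫ s, g η s ∂m) (0 : E →L[ℝ] F) θ :=
    (hasFDerivAt_const c θ).congr_of_eventuallyEq
      (by filter_upwards [hU] with η hη using hconst η hη)
  exact h1.unique h2

theorem fderiv_log_apply {E : Type*} [NormedAddCommGroup E] [NormedSpace ℝ E] {f : E → ℝ}
    {Θ : Set E} (hf : ContDiffOn ℝ 2 f Θ) (hpos : ∀ θ ∈ Θ, 0 < f θ) {θ : E}
    (hθ : θ ∈ interior Θ) :
    fderiv ℝ (fun η => Real.log (f η)) θ = (f θ)⁻¹ • fderiv ℝ f θ :=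
  ((differentiableAt_of_mem_interior hf hθ).hasFDerivAt.log
    (hpos θ (interior_subset hθ)).ne').fderiv

/-- The product rule applied to `∇ log f = f⁻¹ ∇f`. Multiplying by `f` matches integration against
`law m f`, so this one pointwise identity yields both the integrability of products of scores and
the information identity. -/
theorem mul_fderiv_fderiv_log_apply {E : Type*} [NormedAddCommGroup E] [NormedSpace ℝ E]
    {f : E → ℝ} {Θ : Set E} (hf : ContDiffOn ℝ 2 f Θ) (hpos : ∀ θ ∈ Θ, 0 < f θ) {θ : E}
    (hθ : θ ∈ interior Θ) (u v : E) :
    f θ * fderiv ℝ (fderiv ℝ fun η => Real.log (f η)) θ u v =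
      fderiv ℝ (fderiv ℝ f) θ u v -
        f θ * (fderiv ℝ (fun η => Real.log (f η)) θ u * fderiv ℝ (fun η => Real.log (f η)) θ v) := by
  have hne : f θ ≠ 0 := (hpos θ (interior_subset hθ)).ne'
  have heq : fderiv ℝ (fun η => Real.log (f η)) =ᶠ[𝓝 θ] fun η => (f η)⁻¹ • fderiv ℝ f η := by
    filter_upwards [isOpen_interior.mem_nhds hθ] with η hη using fderiv_log_apply hf hpos hη
  have hd := ((hasDerivAt_inv hne).comp_hasFDerivAt θ
    (differentiableAt_of_mem_interior hf hθ).hasFDerivAt).fun_smul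
    (differentiableAt_fderiv_of_mem_interior hf hθ).hasFDerivAt
  simp only [Function.comp_apply] at hd
  rw [heq.fderiv_eq, hd.fderiv, fderiv_log_apply hf hpos hθ]
  simp
  field_simp
  ring

theorem score_eq_toDual_symm {r : ℕ} {S : Type*} (f : Param r → S → ℝ) (θ : Param r) (s : S) :
    score f θ s =
      (InnerProductSpace.toDual ℝ (Param r)).symm (fderiv ℝ (fun η => Real.log (f η s)) θ) :=
  rfl

theorem score_apply {r : ℕ} {S : Type*} (f : Param r → S → ℝ) (θ : Param r) (s : S) (i : Fin r) :
    score f θ s i =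
      fderiv ℝ (fun η => Real.log (f η s)) θ (EuclideanSpace.single i 1) := by
  rw [← InnerProductSpace.toDual_symm_apply, ← score_eq_toDual_symm]
  simp [EuclideanSpace.inner_single_right]

section RegularFamily

variable {r : ℕ} {S : Type*} [MeasurableSpace S] {m : Measure S} {f : Param r → S → ℝ}
  {Θ : Set (Param r)} {θ₀ : Param r}

theorem contDiffOn_log (hf : RegularFamily m f Θ θ₀) (hpos : ∀ θ ∈ Θ, ∀ s, 0 < f θ s) (s : S) :
    ContDiffOn ℝ 2 (fun θ => Real.log (f θ s)) Θ :=
  (hf.smooth s).log fun θ hθ => (hpos θ hθ s).ne'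

theorem stronglyMeasurable_fderiv_log (hf : RegularFamily m f Θ θ₀)
    (hpos : ∀ θ ∈ Θ, ∀ s, 0 < f θ s) (hmeas : ∀ θ ∈ Θ, Measurable (f θ))
    (hθ₀ : θ₀ ∈ interior Θ) :
    StronglyMeasurable fun s => fderiv ℝ (fun η => Real.log (f η s)) θ₀ :=
  stronglyMeasurable_fderiv_of_mem_interior (q := fun η s => Real.log (f η s))
    (fun θ hθ => (hmeas θ hθ).log) (contDiffOn_log hf hpos) hθ₀

theorem integrable_fderiv_fderiv_log (hf : RegularFamily m f Θ θ₀)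
    (hpos : ∀ θ ∈ Θ, ∀ s, 0 < f θ s) (hmeas : ∀ θ ∈ Θ, Measurable (f θ))
    (hθ₀ : θ₀ ∈ interior Θ) :
    Integrable (fun s => fderiv ℝ (fderiv ℝ fun η => Real.log (f η s)) θ₀) (law m (f θ₀)) := by
  obtain ⟨U, hU, K, hK, hb⟩ := hf.logHessian_dominated
  refine hK.mono' (stronglyMeasurable_fderiv_fderiv_of_mem_interior
    (q := fun η s => Real.log (f η s)) (fun θ hθ => (hmeas θ hθ).log) (contDiffOn_log hf hpos)
    hθ₀).aestronglyMeasurable ?_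
  rw [ae_law_iff (hmeas _ (interior_subset hθ₀)) (hpos _ (interior_subset hθ₀))]
  filter_upwards [hb] with s hs
  rw [norm_fderiv_fderiv_eq]
  exact hs _ (mem_of_mem_nhds hU)

/-- The first two derivatives of the densities at the true parameter integrate to zero. -/
theorem integral_fderiv_density (hf : RegularFamily m f Θ θ₀)
    (hpos : ∀ θ ∈ Θ, ∀ s, 0 < f θ s) (hmeas : ∀ θ ∈ Θ, Measurable (f θ))
    (hprob : ∀ θ ∈ Θ, IsProbabilityMeasure (law m (f θ))) (hθ₀ : θ₀ ∈ interior Θ) :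
    (Integrable (fun s => fderiv ℝ (fun η => f η s) θ₀) m ∧
      ∫ s, fderiv ℝ (fun η => f η s) θ₀ ∂m = 0) ∧
    (Integrable (fun s => fderiv ℝ (fderiv ℝ fun η => f η s) θ₀) m ∧
      ∫ s, fderiv ℝ (fderiv ℝ fun η => f η s) θ₀ ∂m = 0) := by
  obtain ⟨U, hU, G, hG, hb⟩ := hf.deriv_dominated
  set O := interior U ∩ interior Θ
  have hO : IsOpen O := isOpen_interior.inter isOpen_interior
  have hθ₀O : θ₀ ∈ O := ⟨mem_interior_iff_mem_nhds.2 hU, hθ₀⟩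
  have hOU : O ⊆ U := Set.inter_subset_left.trans interior_subset
  have hOΘ' : O ⊆ interior Θ := Set.inter_subset_right
  have hOΘ : O ⊆ Θ := hOΘ'.trans interior_subset
  have hD1 : ∀ θ ∈ O, AEStronglyMeasurable (fun s => fderiv ℝ (fun η => f η s) θ) m :=
    fun θ hθ => (stronglyMeasurable_fderiv_of_mem_interior hmeas hf.smooth
      (hOΘ' hθ)).aestronglyMeasurable
  have hD2 : AEStronglyMeasurable (fun s => fderiv ℝ (fderiv ℝ fun η => f η s) θ₀) m :=
    (stronglyMeasurable_fderiv_fderiv_of_mem_interior hmeas hf.smooth hθ₀).aestronglyMeasurable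
  have hb2 : ∀ᵐ s ∂m, ∀ θ ∈ O, ‖fderiv ℝ (fderiv ℝ fun η => f η s) θ‖ ≤ G s := by
    filter_upwards [hb] with s hs θ hθ
    rw [norm_fderiv_fderiv_eq]
    exact (hs θ (hOU hθ)).2
  have hI1 : Integrable (fun s => fderiv ℝ (fun η => f η s) θ₀) m :=
    hG.mono' (hD1 θ₀ hθ₀O) (hb.mono fun s hs => (hs θ₀ (hOU hθ₀O)).1)
  -- Vanishing is needed on all of `O`, not just at `θ₀`: the second differentiation under the
  -- integral is applied to the constant function `θ ↦ ∫ ∇f_θ = 0`.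
  have hzero : ∀ θ ∈ O, ∫ s, fderiv ℝ (fun η => f η s) θ ∂m = 0 := by
    intro θ hθ
    refine integral_fderiv_eq_zero (hO.mem_nhds hθ) (c := 1) (fun η hη => ?_)
      (fun η hη => (hmeas η (hOΘ hη)).aestronglyMeasurable) ?_ (hD1 θ hθ) hG
      (hb.mono fun s hs η hη => (hs η (hOU hη)).1)
      (fun s η hη => differentiableAt_of_mem_interior (hf.smooth s) (hOΘ' hη))
    · have := hprob η (hOΘ hη)
      exact integral_density (hmeas η (hOΘ hη)) (hpos η (hOΘ hη))
    · have := hprob θ (hOΘ hθ)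
      exact integrable_density (hmeas θ (hOΘ hθ)) (hpos θ (hOΘ hθ))
  refine ⟨⟨hI1, hzero θ₀ hθ₀O⟩, hG.mono' hD2 (hb2.mono fun s hs => hs θ₀ hθ₀O), ?_⟩
  exact integral_fderiv_eq_zero (g := fun θ s => fderiv ℝ (fun η => f η s) θ)
    (hO.mem_nhds hθ₀O) hzero hD1 hI1 hD2 hG hb2
    (fun s η hη => differentiableAt_fderiv_of_mem_interior (hf.smooth s) (hOΘ' hη))

theorem integral_fderiv_log (hf : RegularFamily m f Θ θ₀)
    (hpos : ∀ θ ∈ Θ, ∀ s, 0 < f θ s) (hmeas : ∀ θ ∈ Θ, Measurable (f θ))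
    (hprob : ∀ θ ∈ Θ, IsProbabilityMeasure (law m (f θ))) (hθ₀ : θ₀ ∈ interior Θ) :
    ∫ s, fderiv ℝ (fun η => Real.log (f η s)) θ₀ ∂(law m (f θ₀)) = 0 := by
  have hθ₀' := interior_subset hθ₀
  rw [integral_law (hmeas _ hθ₀') (hpos _ hθ₀'),
    ← (integral_fderiv_density hf hpos hmeas hprob hθ₀).1.2]
  refine integral_congr_ae (ae_of_all _ fun s => ?_)
  simp only [fderiv_log_apply (hf.smooth s) (fun θ hθ => hpos θ hθ s) hθ₀]
  exact smul_inv_smul₀ (hpos _ hθ₀' s).ne' _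

/-- Times the density, the product of scores is `∇²f - f ∇² log f`, a difference of two integrable
functions. This is why square integrability of the score is a consequence of the domination
conditions. -/
theorem integrable_mul_fderiv_log (hf : RegularFamily m f Θ θ₀)
    (hpos : ∀ θ ∈ Θ, ∀ s, 0 < f θ s) (hmeas : ∀ θ ∈ Θ, Measurable (f θ))
    (hprob : ∀ θ ∈ Θ, IsProbabilityMeasure (law m (f θ))) (hθ₀ : θ₀ ∈ interior Θ)
    (u v : Param r) :
    Integrable (fun s => fderiv ℝ (fun η => Real.log (f η s)) θ₀ u *
      fderiv ℝ (fun η => Real.log (f η s)) θ₀ v) (law m (f θ₀)) := by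
  have hθ₀' := interior_subset hθ₀
  have h1 := (((integral_fderiv_density hf hpos hmeas hprob hθ₀).2.1.apply_continuousLinearMap
    u).apply_continuousLinearMap v)
  have h2 := (integrable_law_iff (hmeas _ hθ₀') (hpos _ hθ₀')).1
    (((integrable_fderiv_fderiv_log hf hpos hmeas hθ₀).apply_continuousLinearMap
      u).apply_continuousLinearMap v)
  rw [integrable_law_iff (hmeas _ hθ₀') (hpos _ hθ₀')]
  refine (h1.sub h2).congr (ae_of_all _ fun s => ?_)
  have := mul_fderiv_fderiv_log_apply (hf.smooth s) (fun θ hθ => hpos θ hθ s) hθ₀ u v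
  simp only [Pi.sub_apply, smul_eq_mul, this]
  ring

/-- **Information identity**: the expected Hessian of the log-density is minus the second moment
of the score. -/
theorem integral_fderiv_fderiv_log (hf : RegularFamily m f Θ θ₀)
    (hpos : ∀ θ ∈ Θ, ∀ s, 0 < f θ s) (hmeas : ∀ θ ∈ Θ, Measurable (f θ))
    (hprob : ∀ θ ∈ Θ, IsProbabilityMeasure (law m (f θ))) (hθ₀ : θ₀ ∈ interior Θ)
    (u v : Param r) :
    (∫ s, fderiv ℝ (fderiv ℝ fun η => Real.log (f η s)) θ₀ ∂(law m (f θ₀))) u v =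
      -∫ s, fderiv ℝ (fun η => Real.log (f η s)) θ₀ u *
        fderiv ℝ (fun η => Real.log (f η s)) θ₀ v ∂(law m (f θ₀)) := by
  have hθ₀' := interior_subset hθ₀
  have hH := integrable_fderiv_fderiv_log hf hpos hmeas hθ₀
  obtain ⟨hD, hD0⟩ := (integral_fderiv_density hf hpos hmeas hprob hθ₀).2
  rw [ContinuousLinearMap.integral_apply hH,
    ContinuousLinearMap.integral_apply (hH.apply_continuousLinearMap u),
    integral_law (hmeas _ hθ₀') (hpos _ hθ₀'), integral_law (hmeas _ hθ₀') (hpos _ hθ₀')]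
  have hD0' : ∫ s, fderiv ℝ (fderiv ℝ fun η => f η s) θ₀ u v ∂m = 0 := by
    rw [← ContinuousLinearMap.integral_apply (hD.apply_continuousLinearMap u),
      ← ContinuousLinearMap.integral_apply hD, hD0]
    rfl
  have hprod := (integrable_law_iff (hmeas _ hθ₀') (hpos _ hθ₀')).1
    (integrable_mul_fderiv_log hf hpos hmeas hprob hθ₀ u v)
  simp only [smul_eq_mul] at hprod ⊢
  simp_rw [fun s => mul_fderiv_fderiv_log_apply (hf.smooth s) (fun θ hθ => hpos θ hθ s) hθ₀ u v]
  rw [integral_sub ((hD.apply_continuousLinearMap u).apply_continuousLinearMap v)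
    hprod, hD0', zero_sub]

theorem memLp_score (hf : RegularFamily m f Θ θ₀)
    (hpos : ∀ θ ∈ Θ, ∀ s, 0 < f θ s) (hmeas : ∀ θ ∈ Θ, Measurable (f θ))
    (hprob : ∀ θ ∈ Θ, IsProbabilityMeasure (law m (f θ))) (hθ₀ : θ₀ ∈ interior Θ) :
    MemLp (score f θ₀) 2 (law m (f θ₀)) := by
  refine MemLp.of_eval_piLp fun i => ?_
  simp only [score_apply]
  rw [memLp_two_iff_integrable_sq]
  · simpa only [sq] using integrable_mul_fderiv_log hf hpos hmeas hprob hθ₀ _ _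
  · exact ((stronglyMeasurable_fderiv_log hf hpos hmeas hθ₀
      ).aestronglyMeasurable.apply_continuousLinearMap _)

theorem memLp_fderiv_log (hf : RegularFamily m f Θ θ₀)
    (hpos : ∀ θ ∈ Θ, ∀ s, 0 < f θ s) (hmeas : ∀ θ ∈ Θ, Measurable (f θ))
    (hprob : ∀ θ ∈ Θ, IsProbabilityMeasure (law m (f θ))) (hθ₀ : θ₀ ∈ interior Θ) :
    MemLp (fun s => fderiv ℝ (fun η => Real.log (f η s)) θ₀) 2 (law m (f θ₀)) := by
  refine (memLp_congr_norm
    (stronglyMeasurable_fderiv_log hf hpos hmeas hθ₀).aestronglyMeasurable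
    (memLp_score hf hpos hmeas hprob hθ₀).1 (ae_of_all _ fun s => ?_)).2
    (memLp_score hf hpos hmeas hprob hθ₀)
  rw [score_eq_toDual_symm, LinearIsometryEquiv.norm_map]

/-- The variance matrix of the score is its matrix of second moments. -/
theorem dotProduct_scoreVar_mulVec (hf : RegularFamily m f Θ θ₀)
    (hpos : ∀ θ ∈ Θ, ∀ s, 0 < f θ s) (hmeas : ∀ θ ∈ Θ, Measurable (f θ))
    (hprob : ∀ θ ∈ Θ, IsProbabilityMeasure (law m (f θ))) (hθ₀ : θ₀ ∈ interior Θ)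
    (u v : Param r) :
    u ⬝ᵥ (scoreVar m f θ₀).mulVec v =
      ∫ s, fderiv ℝ (fun η => Real.log (f η s)) θ₀ u *
        fderiv ℝ (fun η => Real.log (f η s)) θ₀ v ∂(law m (f θ₀)) := by
  have := hprob θ₀ (interior_subset hθ₀)
  have hL2 := memLp_fderiv_log hf hpos hmeas hprob hθ₀
  have hmean : ∀ w, ∫ s, fderiv ℝ (fun η => Real.log (f η s)) θ₀ w ∂(law m (f θ₀)) = 0 := by
    intro w
    rw [← ContinuousLinearMap.integral_apply (hL2.integrable one_le_two),
      integral_fderiv_log hf hpos hmeas hprob hθ₀]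
    rfl
  have hrepr : ∀ w : Param r, w = ∑ i, w i • EuclideanSpace.single i (1 : ℝ) := by
    intro w
    ext j
    simp [Finset.sum_apply, Pi.single_apply]
  have hentry : ∀ i j, scoreVar m f θ₀ i j =
      ∫ s, fderiv ℝ (fun η => Real.log (f η s)) θ₀ (EuclideanSpace.single i 1) *
        fderiv ℝ (fun η => Real.log (f η s)) θ₀ (EuclideanSpace.single j 1)
          ∂(law m (f θ₀)) := by
    intro i j
    simp only [scoreVar, Matrix.of_apply, score_apply, covariance, hmean, sub_zero]
  have hterm : ∀ i j, Integrable (fun s =>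
      (u i * fderiv ℝ (fun η => Real.log (f η s)) θ₀ (EuclideanSpace.single i 1)) *
        (v j * fderiv ℝ (fun η => Real.log (f η s)) θ₀ (EuclideanSpace.single j 1)))
          (law m (f θ₀)) := fun i j => by
    refine ((integrable_mul_fderiv_log hf hpos hmeas hprob hθ₀ (EuclideanSpace.single i 1)
      (EuclideanSpace.single j 1)).const_mul (u i * v j)).congr (ae_of_all _ fun s => ?_)
    simp only
    ring
  conv_rhs => rw [hrepr u, hrepr v]
  simp only [map_sum, map_smul, Finset.sum_mul_sum, smul_eq_mul]
  rw [integral_finsetSum _ fun i _ => ?_]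
  · simp only [dotProduct, Matrix.mulVec, Finset.mul_sum]
    refine Finset.sum_congr rfl fun i _ => ?_
    rw [integral_finsetSum _ fun j _ => ?_]
    · refine Finset.sum_congr rfl fun j _ => ?_
      rw [hentry, ← integral_mul_const, ← integral_const_mul]
      refine integral_congr_ae (ae_of_all _ fun s => ?_)
      simp only
      ring
    · exact hterm i j
  · exact integrable_finsetSum _ fun j _ => hterm i j

end RegularFamily

/-! ### M-estimators under the information identity. -/

theorem posSemidef_of_moments {S ι : Type*} [MeasurableSpace S] [Fintype ι] [DecidableEq ι]
    {ν : Measure S} {l : S → EuclideanSpace ℝ ι →L[ℝ] ℝ} {C : Matrix ι ι ℝ}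
    (hC : ∀ u v : EuclideanSpace ℝ ι, ∫ s, l s u * l s v ∂ν = u ⬝ᵥ C.mulVec v) :
    C.PosSemidef := by
  refine .of_dotProduct_mulVec_nonneg ?_ fun x => ?_
  · ext i j
    have hentry : ∀ i j, C i j =
        ∫ s, l s (EuclideanSpace.single i 1) * l s (EuclideanSpace.single j 1) ∂ν := fun i j => by
      rw [hC]
      simp
    simp only [Matrix.conjTranspose_apply, star_trivial, hentry, mul_comm]
  · have := hC (WithLp.toLp 2 x) (WithLp.toLp 2 x)
    simp only [star_trivial]
    rw [← this]
    exact integral_nonneg fun s => mul_self_nonneg _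

/-- **Asymptotic normality of M-estimators satisfying the information identity**: if the expected
Hessian of the criterion is minus the second moment `C` of its gradient, the limit is
`N(0, C⁻¹)`. -/
theorem mEstimator_tendstoInDistribution_of_information {Ω S ι : Type*} [MeasurableSpace Ω]
    [MeasurableSpace S] [Fintype ι] [DecidableEq ι]
    {P : Measure Ω} [IsProbabilityMeasure P] {ν : Measure S} [IsFiniteMeasure ν]
    {W : ℕ → Ω → S} (hindep : iIndepFun W P) (hlaw : ∀ i, HasLaw (W i) ν P)
    {Θ : Set (EuclideanSpace ℝ ι)} (hΘ : IsCompact Θ) {θ₀ : EuclideanSpace ℝ ι}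
    (hθ₀ : θ₀ ∈ interior Θ)
    {q : EuclideanSpace ℝ ι → S → ℝ} (hmeas : ∀ θ ∈ Θ, Measurable (q θ))
    (hsmooth : ∀ s, ContDiffOn ℝ 2 (fun θ => q θ s) Θ)
    {K : S → ℝ} (hK : Integrable K ν) (hqK : ∀ᵐ s ∂ν, ∀ θ ∈ Θ, |q θ s| ≤ K s)
    (hmax : ∀ θ ∈ Θ, θ ≠ θ₀ → ∫ s, q θ s ∂ν < ∫ s, q θ₀ s ∂ν)
    {U : Set (EuclideanSpace ℝ ι)} (hU : U ∈ 𝓝 θ₀) {H : S → ℝ} (hH : Integrable H ν)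
    (hqH : ∀ᵐ s ∂ν, ∀ θ ∈ U, ‖fderiv ℝ (fderiv ℝ fun η => q η s) θ‖ ≤ H s)
    (hL2 : MemLp (fun s => fderiv ℝ (fun η => q η s) θ₀) 2 ν)
    (hmean : ∫ s, fderiv ℝ (fun η => q η s) θ₀ ∂ν = 0)
    {C : Matrix ι ι ℝ} (hdet : C.det ≠ 0)
    (hcov : ∀ u v : EuclideanSpace ℝ ι,
      ∫ s, fderiv ℝ (fun η => q η s) θ₀ u * fderiv ℝ (fun η => q η s) θ₀ v ∂ν =
        u ⬝ᵥ C.mulVec v)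
    (hinfo : ∀ u v : EuclideanSpace ℝ ι,
      (∫ s, fderiv ℝ (fderiv ℝ fun η => q η s) θ₀ ∂ν) u v = -(u ⬝ᵥ C.mulVec v))
    {t : ℕ → Ω → EuclideanSpace ℝ ι} (htm : ∀ n, AEMeasurable (t n) P)
    (ht : ∀ n, ∀ᵐ ω ∂P, t n ω ∈ Θ ∧
      IsMaxOn (fun θ => ∑ i ∈ Finset.range n, q θ (W i ω)) Θ (t n ω)) :
    TendstoInDistribution (fun (n : ℕ) ω => √(n : ℝ) • (t n ω - θ₀)) atTop id
      (fun _ => P) (multivariateGaussian 0 C⁻¹) := by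
  have hC : C.PosSemidef := posSemidef_of_moments hcov
  have hunit : IsUnit C.det := isUnit_iff_ne_zero.2 hdet
  set A := Matrix.toEuclideanCLM (𝕜 := ℝ) C
  set B := Matrix.toEuclideanCLM (𝕜 := ℝ) C⁻¹
  have hBA : ∀ u, B (A u) = u := fun u => by
    have : B * A = 1 := by rw [← map_mul, Matrix.nonsing_inv_mul _ hunit, map_one]
    exact DFunLike.congr_fun this u
  have hAB : ∀ u, A (B u) = u := fun u => by
    have : A * B = 1 := by rw [← map_mul, Matrix.mul_nonsing_inv _ hunit, map_one]
    exact DFunLike.congr_fun this u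
  have hinnerA : ∀ u v : EuclideanSpace ℝ ι, inner ℝ u (A v) = u ⬝ᵥ C.mulVec v :=
    fun u v => Matrix.inner_toEuclideanCLM C u v
  have hsymA : ∀ u v : EuclideanSpace ℝ ι, inner ℝ (A u) v = inner ℝ u (A v) := fun u v => by
    rw [real_inner_comm, hinnerA, hinnerA, ← hcov, ← hcov]
    simp only [mul_comm]
  have hsymB : ∀ u v : EuclideanSpace ℝ ι, inner ℝ (B u) v = inner ℝ u (B v) := fun u v => by
    conv_lhs => rw [← hAB v, ← hsymA, hAB]
  -- The inverse Riesz map is typed as conjugate-linear; over `ℝ` conjugation is trivial, so it can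
  -- be repackaged as a linear map.
  set D : (EuclideanSpace ℝ ι →L[ℝ] ℝ) →L[ℝ] EuclideanSpace ℝ ι :=
    { toFun := (InnerProductSpace.toDual ℝ (EuclideanSpace ℝ ι)).symm
      map_add' := map_add _
      map_smul' := fun c l => by simp
      cont := LinearIsometryEquiv.continuous _ }
  have hDinner : ∀ l v, inner ℝ (D l) v = l v := fun l v =>
    InnerProductSpace.toDual_symm_apply
  -- Since the expected Hessian is `-C`, the Newton map is `C⁻¹` after the Riesz map. The influence
  -- function then has covariance `C⁻¹ C C⁻¹ = C⁻¹`.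
  refine mEstimator_tendstoInDistribution hindep hlaw hΘ hθ₀ hmeas hsmooth hK hqK hmax hU hH hqH
    (J := B.comp D) (fun u => ?_) ((B.comp D).comp_memLp' hL2) ?_ hC.inv (fun u => ?_) htm ht
  · have : D ((∫ s, fderiv ℝ (fderiv ℝ fun η => q η s) θ₀ ∂ν) u) = -A u := by
      refine ext_inner_right ℝ fun v => ?_
      rw [hDinner, hinfo, inner_neg_left, hsymA, hinnerA]
    rw [ContinuousLinearMap.comp_apply, this, map_neg, hBA]
  · rw [(B.comp D).integral_comp_comm (hL2.integrable one_le_two), hmean, map_zero]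
  · have h1 : ∀ s, inner ℝ u ((B.comp D) (fderiv ℝ (fun η => q η s) θ₀)) =
        fderiv ℝ (fun η => q η s) θ₀ (B u) := fun s => by
      rw [ContinuousLinearMap.comp_apply, ← hsymB, real_inner_comm, hDinner]
    simp only [h1, sq]
    rw [hcov, ← hinnerA, hAB, hsymB]
    exact Matrix.inner_toEuclideanCLM _ u u

/-! ### Identification of the true parameter by relative entropy. -/

/-- **Gibbs' inequality**: the expected log-density is at most that of the true density, with
equality only if the densities agree almost everywhere. -/
theorem integral_log_le_and_ae_eq {S : Type*} [MeasurableSpace S] {m : Measure S} {f g : S → ℝ}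
    (hf : Measurable f) (hfpos : ∀ s, 0 < f s) [IsProbabilityMeasure (law m f)]
    (hg : Measurable g) (hgpos : ∀ s, 0 < g s) [IsProbabilityMeasure (law m g)]
    (hlf : Integrable (fun s => Real.log (f s)) (law m f))
    (hlg : Integrable (fun s => Real.log (g s)) (law m f)) :
    ∫ s, Real.log (g s) ∂(law m f) ≤ ∫ s, Real.log (f s) ∂(law m f) ∧
    (∫ s, Real.log (g s) ∂(law m f) = ∫ s, Real.log (f s) ∂(law m f) → g =ᵐ[m] f) := by
  have hfg : ∀ s, f s • (g s / f s) = g s := fun s => mul_div_cancel₀ _ (hfpos s).ne'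
  have hratio : Integrable (fun s => g s / f s) (law m f) := by
    rw [integrable_law_iff hf hfpos]
    simpa only [hfg] using integrable_density hg hgpos
  have hratio1 : ∫ s, g s / f s ∂(law m f) = 1 := by
    rw [integral_law hf hfpos]
    simpa only [hfg] using integral_density hg hgpos
  have hlog : ∀ s, Real.log (g s / f s) = Real.log (g s) - Real.log (f s) := fun s =>
    Real.log_div (hgpos s).ne' (hfpos s).ne'
  -- `h` is `x - 1 - log x` at `x = g / f`: it is nonnegative and vanishes only at `x = 1`. As `x`
  -- has mean one under `law m f`, the integral of `h` is the relative entropy.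
  set h : S → ℝ := fun s => (g s / f s - 1) - (Real.log (g s) - Real.log (f s)) with hh
  have hnn : ∀ s, 0 ≤ h s := fun s => by
    have := Real.log_le_sub_one_of_pos (div_pos (hgpos s) (hfpos s))
    rw [hlog] at this
    simp only [hh]
    linarith
  have hint : Integrable h (law m f) :=
    (hratio.sub (integrable_const 1)).sub (hlg.sub hlf)
  have hval : ∫ s, h s ∂(law m f) =
      ∫ s, Real.log (f s) ∂(law m f) - ∫ s, Real.log (g s) ∂(law m f) := by
    have h1 := integral_sub (hratio.sub (integrable_const 1)) (hlg.sub hlf)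
    simp only [Pi.sub_apply] at h1
    rw [h1, integral_sub hratio (integrable_const 1), integral_sub hlg hlf, hratio1]
    simp
  refine ⟨by linarith [integral_nonneg (μ := law m f) (f := h) hnn], fun heq => ?_⟩
  have h0 : ∫ s, h s ∂(law m f) = 0 := by rw [hval, heq, sub_self]
  have hae := (integral_eq_zero_iff_of_nonneg hnn hint).1 h0
  rw [EventuallyEq, ae_law_iff hf hfpos] at hae
  filter_upwards [hae] with s hs
  by_contra hne
  have := Real.log_lt_sub_one_of_pos (div_pos (hgpos s) (hfpos s))
    (fun h => hne ((div_eq_one_iff_eq (hfpos s).ne').1 h))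
  rw [hlog] at this
  simp only [hh, Pi.zero_apply] at hs
  linarith

/-! ### Splitting an expectation over the label indicator. -/

section Mixture

variable {T : Type*} [MeasurableSpace T] {Q : Measure T} [SFinite Q] {lam : ℝ}

/-- `Bin(1, lam)` has only the atoms 1 and 0, so the product is a weighted sum of two copies of `Q`,
on the slices `z = 1` and `z = 0`. Everything about the observation can then be checked slice by
slice. -/
theorem prod_indicatorLaw (Q : Measure T) [SFinite Q] (lam : ℝ) :
    Q.prod (indicatorLaw lam) =
      ENNReal.ofReal lam • Q.map (fun s => (s, (1 : ℝ))) +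
        ENNReal.ofReal (1 - lam) • Q.map (fun s => (s, (0 : ℝ))) := by
  rw [indicatorLaw, Measure.prod_add, Measure.prod_smul_right, Measure.prod_smul_right,
    Measure.prod_dirac, Measure.prod_dirac]

theorem ae_prod_indicatorLaw {p : T × ℝ → Prop} (h1 : ∀ᵐ s ∂Q, p (s, 1))
    (h0 : ∀ᵐ s ∂Q, p (s, 0)) : ∀ᵐ w ∂(Q.prod (indicatorLaw lam)), p w := by
  rw [prod_indicatorLaw, ae_add_measure_iff]
  exact ⟨Measure.ae_smul_measure ((measurableEmbedding_prod_mk_right 1).ae_map_iff.2 h1) _,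
    Measure.ae_smul_measure ((measurableEmbedding_prod_mk_right 0).ae_map_iff.2 h0) _⟩

theorem integrable_prod_indicatorLaw {F : Type*} [NormedAddCommGroup F] {h : T × ℝ → F}
    (h1 : Integrable (fun s => h (s, 1)) Q) (h0 : Integrable (fun s => h (s, 0)) Q) :
    Integrable h (Q.prod (indicatorLaw lam)) := by
  rw [prod_indicatorLaw]
  exact (((measurableEmbedding_prod_mk_right 1).integrable_map_iff.2 h1).smul_measure
    ENNReal.ofReal_ne_top).add_measure
    (((measurableEmbedding_prod_mk_right 0).integrable_map_iff.2 h0).smul_measure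
      ENNReal.ofReal_ne_top)

theorem integral_prod_indicatorLaw {F : Type*} [NormedAddCommGroup F] [NormedSpace ℝ F]
    (hlam0 : 0 ≤ lam) (hlam1 : lam ≤ 1) {h : T × ℝ → F}
    (h1 : Integrable (fun s => h (s, 1)) Q) (h0 : Integrable (fun s => h (s, 0)) Q) :
    ∫ w, h w ∂(Q.prod (indicatorLaw lam)) =
      lam • ∫ s, h (s, 1) ∂Q + (1 - lam) • ∫ s, h (s, 0) ∂Q := by
  rw [prod_indicatorLaw, integral_add_measure, integral_smul_measure, integral_smul_measure,
    (measurableEmbedding_prod_mk_right _).integral_map,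
    (measurableEmbedding_prod_mk_right _).integral_map, ENNReal.toReal_ofReal hlam0,
    ENNReal.toReal_ofReal (sub_nonneg.2 hlam1)]
  · exact ((measurableEmbedding_prod_mk_right 1).integrable_map_iff.2 h1).smul_measure
      ENNReal.ofReal_ne_top
  · exact ((measurableEmbedding_prod_mk_right 0).integrable_map_iff.2 h0).smul_measure
      ENNReal.ofReal_ne_top

theorem memLp_two_prod_indicatorLaw [IsFiniteMeasure Q] {F : Type*} [NormedAddCommGroup F]
    {h : T × ℝ → F} (h1 : MemLp (fun s => h (s, 1)) 2 Q) (h0 : MemLp (fun s => h (s, 0)) 2 Q) :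
    MemLp h 2 (Q.prod (indicatorLaw lam)) := by
  rw [memLp_two_iff_integrable_sq_norm (integrable_prod_indicatorLaw (h1.integrable one_le_two)
    (h0.integrable one_le_two)).aestronglyMeasurable]
  exact integrable_prod_indicatorLaw
    ((memLp_two_iff_integrable_sq_norm h1.aestronglyMeasurable).1 h1)
    ((memLp_two_iff_integrable_sq_norm h0.aestronglyMeasurable).1 h0)

end Mixture

/-! ### Marginal densities. -/

theorem ofReal_marginal {r : ℕ} {𝒳 𝒴 : Type*} {p : Param r → 𝒳 × 𝒴 → ℝ} {θ : Param r}
    (hpos : ∀ s, 0 < p θ s) (hsum : ∀ x, Summable fun y => p θ (x, y))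
    (x : 𝒳) : ENNReal.ofReal (marginal p θ x) = ∑' y, ENNReal.ofReal (p θ (x, y)) :=
  ENNReal.ofReal_tsum_of_nonneg (fun _ => (hpos _).le) (hsum x)

theorem marginal_pos {r : ℕ} {𝒳 𝒴 : Type*} [Nonempty 𝒴] {p : Param r → 𝒳 × 𝒴 → ℝ}
    {θ : Param r} (hpos : ∀ s, 0 < p θ s) (hsum : ∀ x, Summable fun y => p θ (x, y)) (x : 𝒳) :
    0 < marginal p θ x :=
  (hsum x).tsum_pos (fun _ => (hpos _).le) (Classical.arbitrary 𝒴) (hpos _)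

theorem measurable_marginal {r : ℕ} {𝒳 𝒴 : Type*} [MeasurableSpace 𝒳] [MeasurableSpace 𝒴]
    [Countable 𝒴] {p : Param r → 𝒳 × 𝒴 → ℝ} {θ : Param r}
    (hmeas : Measurable (p θ)) (hpos : ∀ s, 0 < p θ s)
    (hsum : ∀ x, Summable fun y => p θ (x, y)) : Measurable (marginal p θ) := by
  have h1 : Measurable fun x => ∑' y, ENNReal.ofReal (p θ (x, y)) :=
    Measurable.tsum fun y => (hmeas.comp measurable_prodMk_right).ennreal_ofReal
  have h2 : marginal p θ = fun x => (∑' y, ENNReal.ofReal (p θ (x, y))).toReal := by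
    funext x
    rw [← ofReal_marginal hpos hsum, ENNReal.toReal_ofReal]
    exact tsum_nonneg fun _ => (hpos _).le
  rw [h2]
  exact h1.ennreal_toReal

/-- The law of the first coordinate under a joint density has the marginal density. -/
theorem map_fst_law {r : ℕ} {𝒳 𝒴 : Type*} [MeasurableSpace 𝒳] [MeasurableSpace 𝒴]
    [Countable 𝒴] [MeasurableSingletonClass 𝒴] {μ : Measure 𝒳} [SFinite μ]
    {p : Param r → 𝒳 × 𝒴 → ℝ} {θ : Param r}
    (hmeas : Measurable (p θ)) (hpos : ∀ s, 0 < p θ s)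
    (hsum : ∀ x, Summable fun y => p θ (x, y)) :
    (law (μ.prod Measure.count) (p θ)).map Prod.fst = law μ (marginal p θ) := by
  ext A hA
  -- Tonelli on `A ×ˢ univ`: the inner integral over the counting measure is the sum over labels
  -- that defines the marginal density.
  rw [Measure.map_apply measurable_fst hA, law, law,
    withDensity_apply _ (measurable_fst hA), withDensity_apply _ hA, ← Set.prod_univ,
    ← Measure.prod_restrict, Measure.restrict_univ,
    lintegral_prod _ hmeas.ennreal_ofReal.aemeasurable]
  simp only [lintegral_count, ofReal_marginal hpos hsum]

/-! ### The semi-supervised criterion as an M-estimation problem. -/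

/-- The contribution of an observation `((x, y), z)` to the semi-supervised log-likelihood. -/
noncomputable def logLikTerm {r : ℕ} {𝒳 𝒴 : Type*} (p : Param r → 𝒳 × 𝒴 → ℝ) (θ : Param r)
    (w : (𝒳 × 𝒴) × ℝ) : ℝ :=
  w.2 * Real.log (p θ w.1) + (1 - w.2) * Real.log (marginal p θ w.1.1)

section

variable {r : ℕ} {𝒳 𝒴 : Type*} {p : Param r → 𝒳 × 𝒴 → ℝ}

theorem logLikTerm_one (θ : Param r) (s : 𝒳 × 𝒴) :
    logLikTerm p θ (s, 1) = Real.log (p θ s) := by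
  simp [logLikTerm]

theorem logLikTerm_zero (θ : Param r) (s : 𝒳 × 𝒴) :
    logLikTerm p θ (s, 0) = Real.log (marginal p θ s.1) := by
  simp [logLikTerm]

theorem logLik_eq_sum (X : ℕ → 𝒳) (Y : ℕ → 𝒴) (Z : ℕ → ℝ) (n : ℕ) (θ : Param r) :
    logLik p X Y Z n θ = ∑ i ∈ Finset.range n, logLikTerm p θ ((X i, Y i), Z i) := by
  simp only [logLik, logLikTerm, Finset.sum_add_distrib]

end

theorem integral_comp_of_measurePreserving {S T F : Type*} [MeasurableSpace S]
    [MeasurableSpace T] [NormedAddCommGroup F] [NormedSpace ℝ F] {Q : Measure S} {Q' : Measure T}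
    {φ : S → T} (hφ : MeasurePreserving φ Q Q') {g : T → F} (hg : AEStronglyMeasurable g Q') :
    ∫ s, g (φ s) ∂Q = ∫ x, g x ∂Q' :=
  hφ.hasLaw.integral_comp hg

/-- Asymptotic normality of the semi-supervised maximum likelihood estimator, given that the
marginal densities are positive, measurable and have total mass one. -/
theorem semiSupervised_tendstoInDistribution {r : ℕ} {𝒳 𝒴 Ω : Type*}
    [MeasurableSpace 𝒳] [MeasurableSpace 𝒴] [MeasurableSpace Ω]
    {P : Measure Ω} [IsProbabilityMeasure P] {μ : Measure 𝒳} {m : Measure (𝒳 × 𝒴)}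
    {Θ : Set (Param r)} (hΘ : IsCompact Θ) {θ₀ : Param r} (hθ₀ : θ₀ ∈ interior Θ)
    {p : Param r → 𝒳 × 𝒴 → ℝ}
    (hmeas : ∀ θ ∈ Θ, Measurable (p θ)) (hpos : ∀ θ ∈ Θ, ∀ s, 0 < p θ s)
    (hprob : ∀ θ ∈ Θ, IsProbabilityMeasure (law m (p θ)))
    (hmeas' : ∀ θ ∈ Θ, Measurable (marginal p θ)) (hpos' : ∀ θ ∈ Θ, ∀ x, 0 < marginal p θ x)
    (hprob' : ∀ θ ∈ Θ, IsProbabilityMeasure (law μ (marginal p θ)))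
    (hfst : MeasurePreserving Prod.fst (law m (p θ₀)) (law μ (marginal p θ₀)))
    (hident : Identifiable m p Θ)
    (hjoint : RegularFamily m p Θ θ₀) (hmarg : RegularFamily μ (marginal p) Θ θ₀)
    {lam : ℝ} (hlam_pos : 0 < lam) (hlam_le : lam ≤ 1)
    {C : Matrix (Fin r) (Fin r) ℝ}
    (hC : C = lam • scoreVar m p θ₀ + (1 - lam) • scoreVar μ (marginal p) θ₀)
    (hdet : C.det ≠ 0)
    {W : ℕ → Ω → (𝒳 × 𝒴) × ℝ} (hindep : iIndepFun W P)
    (hlaw : ∀ i, HasLaw (W i) ((law m (p θ₀)).prod (indicatorLaw lam)) P)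
    {t : ℕ → Ω → Param r} (htm : ∀ n, AEMeasurable (t n) P)
    (ht : ∀ n, ∀ᵐ ω ∂P, t n ω ∈ Θ ∧
      IsMaxOn (fun θ => ∑ i ∈ Finset.range n, logLikTerm p θ (W i ω)) Θ (t n ω)) :
    TendstoInDistribution (fun (n : ℕ) ω => √(n : ℝ) • (t n ω - θ₀)) atTop id
      (fun _ => P) (multivariateGaussian 0 C⁻¹) := by
  have hθ₀' := interior_subset hθ₀
  have := hprob θ₀ hθ₀'
  have := hprob' θ₀ hθ₀'
  have : IsProbabilityMeasure ((law m (p θ₀)).prod (indicatorLaw lam)) :=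
    (hlaw 0).isProbabilityMeasure_iff.1 inferInstance
  set Q := law m (p θ₀) with hQ
  set Q' := law μ (marginal p θ₀) with hQ'
  have hae : ∀ {c : 𝒳 × 𝒴 → Prop}, (∀ᵐ s ∂m, c s) → ∀ᵐ s ∂Q, c s :=
    fun h => (ae_law_iff (hmeas _ hθ₀') (hpos _ hθ₀')).2 h
  have hae' : ∀ {c : 𝒳 → Prop}, (∀ᵐ x ∂μ, c x) → ∀ᵐ s ∂Q, c s.1 := fun h =>
    hfst.quasiMeasurePreserving.ae ((ae_law_iff (hmeas' _ hθ₀') (hpos' _ hθ₀')).2 h)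
  obtain ⟨K₁, hK₁, hb₁⟩ := hjoint.log_dominated
  obtain ⟨K₂, hK₂, hb₂⟩ := hmarg.log_dominated
  obtain ⟨U₁, hU₁, H₁, hH₁, hh₁⟩ := hjoint.logHessian_dominated
  obtain ⟨U₂, hU₂, H₂, hH₂, hh₂⟩ := hmarg.logHessian_dominated
  have hlog₁ : ∀ θ ∈ Θ, Integrable (fun s => Real.log (p θ s)) Q := fun θ hθ =>
    hK₁.mono' (hmeas θ hθ).log.aestronglyMeasurable ((hae hb₁).mono fun s hs => hs θ hθ)
  have hlog₂ : ∀ θ ∈ Θ, Integrable (fun x => Real.log (marginal p θ x)) Q' := fun θ hθ =>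
    hK₂.mono' (hmeas' θ hθ).log.aestronglyMeasurable
      (((ae_law_iff (hmeas' _ hθ₀') (hpos' _ hθ₀')).2 hb₂).mono fun s hs => hs θ hθ)
  have hL2₁ := memLp_fderiv_log hjoint hpos hmeas hprob hθ₀
  have hL2₂ := memLp_fderiv_log hmarg hpos' hmeas' hprob' hθ₀
  have hHess₁ := integrable_fderiv_fderiv_log hjoint hpos hmeas hθ₀
  have hHess₂ := integrable_fderiv_fderiv_log hmarg hpos' hmeas' hθ₀
  -- Envelopes are mixed as the criterion is: the combined one equals `K₁` on `z = 1` and `K₂` on `z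
  -- = 0`. It serves for both the log-densities and the Hessians.
  have hmix : ∀ {K₁ : 𝒳 × 𝒴 → ℝ} {K₂ : 𝒳 → ℝ}, Integrable K₁ Q → Integrable K₂ Q' →
      Integrable (fun w : (𝒳 × 𝒴) × ℝ => w.2 * K₁ w.1 + (1 - w.2) * K₂ w.1.1)
        (Q.prod (indicatorLaw lam)) := fun h₁ h₂ =>
    integrable_prod_indicatorLaw (by simpa using h₁)
      (by simpa [Function.comp_def] using
        hfst.integrable_comp_of_integrable h₂)
  have hmean : ∀ θ ∈ Θ, ∫ w, logLikTerm p θ w ∂(Q.prod (indicatorLaw lam)) =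
      lam * ∫ s, Real.log (p θ s) ∂Q + (1 - lam) * ∫ x, Real.log (marginal p θ x) ∂Q' := by
    intro θ hθ
    rw [integral_prod_indicatorLaw hlam_pos.le hlam_le]
    · simp only [logLikTerm_one, logLikTerm_zero, smul_eq_mul]
      rw [integral_comp_of_measurePreserving hfst (g := fun x => Real.log (marginal p θ x))
        (hmeas' θ hθ).log.aestronglyMeasurable]
    · simpa only [logLikTerm_one] using hlog₁ θ hθ
    · simpa only [logLikTerm_zero, Function.comp_def] using
        hfst.integrable_comp_of_integrable (hlog₂ θ hθ)
  refine mEstimator_tendstoInDistribution_of_information (q := logLikTerm p) hindep hlaw hΘ hθ₀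
    (fun θ hθ => ?_) (fun w => ?_) (hmix hK₁ hK₂)
    (ae_prod_indicatorLaw (by simpa [logLikTerm_one] using hae hb₁)
      (by simpa [logLikTerm_zero] using hae' hb₂))
    (fun θ hθ hne => ?_) (inter_mem hU₁ hU₂) (hmix hH₁ hH₂) (ae_prod_indicatorLaw ?_ ?_)
    (memLp_two_prod_indicatorLaw (by simpa only [logLikTerm_one] using hL2₁)
      (by simpa only [logLikTerm_zero, Function.comp_def] using
        hL2₂.comp_measurePreserving hfst)) ?_ hdet
    (fun u v => ?_) (fun u v => ?_) htm ht
  · exact (measurable_snd.mul ((hmeas θ hθ).comp measurable_fst).log).add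
      ((measurable_const.sub measurable_snd).mul
        ((hmeas' θ hθ).comp (measurable_fst.comp measurable_fst)).log)
  · exact (contDiffOn_const.mul (contDiffOn_log hjoint hpos _)).add
      (contDiffOn_const.mul (contDiffOn_log hmarg hpos' _))
  · have := hprob θ hθ
    have := hprob' θ hθ
    obtain ⟨hle₁, heq₁⟩ := integral_log_le_and_ae_eq (m := m) (hmeas θ₀ hθ₀') (hpos θ₀ hθ₀')
      (hmeas θ hθ) (hpos θ hθ) (hlog₁ θ₀ hθ₀') (hlog₁ θ hθ)
    have hle₂ := (integral_log_le_and_ae_eq (m := μ) (hmeas' θ₀ hθ₀') (hpos' θ₀ hθ₀')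
      (hmeas' θ hθ) (hpos' θ hθ) (hlog₂ θ₀ hθ₀') (hlog₂ θ hθ)).1
    -- Only the joint family is identifiable, so strictness comes from the joint term alone and
    -- survives because its weight `lam` is positive; the marginal term contributes a weak
    -- inequality.
    have hlt := lt_of_le_of_ne hle₁ fun h => hident θ hθ θ₀ hθ₀' hne (heq₁ h)
    rw [hmean θ hθ, hmean θ₀ hθ₀']
    exact add_lt_add_of_lt_of_le (mul_lt_mul_of_pos_left hlt hlam_pos)
      (mul_le_mul_of_nonneg_left hle₂ (sub_nonneg.2 hlam_le))
  · filter_upwards [hae hh₁] with s hs θ hθ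
    simp only [logLikTerm_one, norm_fderiv_fderiv_eq]
    simpa using hs θ hθ.1
  · filter_upwards [hae' hh₂] with s hs θ hθ
    simp only [logLikTerm_zero, norm_fderiv_fderiv_eq]
    simpa using hs θ hθ.2
  · rw [integral_prod_indicatorLaw hlam_pos.le hlam_le]
    · simp only [logLikTerm_one, logLikTerm_zero]
      rw [integral_comp_of_measurePreserving hfst
        (g := fun x => fderiv ℝ (fun η => Real.log (marginal p η x)) θ₀) hL2₂.1,
        integral_fderiv_log hjoint hpos hmeas hprob hθ₀,
        integral_fderiv_log hmarg hpos' hmeas' hprob' hθ₀, smul_zero, smul_zero, add_zero]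
    · simpa only [logLikTerm_one] using hL2₁.integrable one_le_two
    · simpa only [logLikTerm_zero, Function.comp_def] using
        (hL2₂.comp_measurePreserving hfst).integrable one_le_two
  -- No cross terms between the two scores occur: on each slice the gradient of the criterion is
  -- exactly one of them. The second moment is thus the weighted sum `C`.
  · have hI₂ := integrable_mul_fderiv_log hmarg hpos' hmeas' hprob' hθ₀ u v
    rw [integral_prod_indicatorLaw hlam_pos.le hlam_le]
    · simp only [logLikTerm_one, logLikTerm_zero]
      rw [integral_comp_of_measurePreserving hfst
        (g := fun x => fderiv ℝ (fun η => Real.log (marginal p η x)) θ₀ u *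
          fderiv ℝ (fun η => Real.log (marginal p η x)) θ₀ v) hI₂.1,
        ← dotProduct_scoreVar_mulVec hjoint hpos hmeas hprob hθ₀,
        ← dotProduct_scoreVar_mulVec hmarg hpos' hmeas' hprob' hθ₀, hC]
      simp [Matrix.add_mulVec, Matrix.smul_mulVec, dotProduct_add, dotProduct_smul]
    · simpa only [logLikTerm_one] using
        integrable_mul_fderiv_log hjoint hpos hmeas hprob hθ₀ u v
    · simpa only [logLikTerm_zero, Function.comp_def] using
        hfst.integrable_comp_of_integrable hI₂
  -- The information identity holds on each slice separately, for the joint and for the marginal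
  -- family, so it passes to the mixture.
  · rw [integral_prod_indicatorLaw hlam_pos.le hlam_le]
    · simp only [logLikTerm_one, logLikTerm_zero]
      rw [integral_comp_of_measurePreserving hfst
        (g := fun x => fderiv ℝ (fderiv ℝ fun η => Real.log (marginal p η x)) θ₀) hHess₂.1]
      simp only [add_apply, smul_apply]
      rw [integral_fderiv_fderiv_log hjoint hpos hmeas hprob hθ₀,
        integral_fderiv_fderiv_log hmarg hpos' hmeas' hprob' hθ₀,
        ← dotProduct_scoreVar_mulVec hjoint hpos hmeas hprob hθ₀,
        ← dotProduct_scoreVar_mulVec hmarg hpos' hmeas' hprob' hθ₀, hC]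
      simp [Matrix.add_mulVec, Matrix.smul_mulVec, dotProduct_add, dotProduct_smul]
      ring
    · simpa only [logLikTerm_one] using hHess₁
    · simpa only [logLikTerm_zero, Function.comp_def] using
        hfst.integrable_comp_of_integrable hHess₂

end SemiSup

/-! ### The main theorem. -/

theorem proposition2 {r : ℕ} {𝒳 𝒴 Ω : Type*}
    [MeasurableSpace 𝒳] [MeasurableSpace 𝒴] [Countable 𝒴] [MeasurableSingletonClass 𝒴]
    [MeasurableSpace Ω] (P : Measure Ω) [IsProbabilityMeasure P]
    (μ : Measure 𝒳) [SigmaFinite μ]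
    (Θ : Set (SemiSup.Param r)) (hΘ : IsCompact Θ) (hΘconv : Convex ℝ Θ)
    (θ₀ : SemiSup.Param r) (hθ₀ : θ₀ ∈ interior Θ)
    (p : SemiSup.Param r → 𝒳 × 𝒴 → ℝ)
    (hp_meas : ∀ θ ∈ Θ, Measurable (p θ))
    (hp_pos : ∀ θ ∈ Θ, ∀ s, 0 < p θ s)
    (hp_prob : ∀ θ ∈ Θ, IsProbabilityMeasure (SemiSup.law (μ.prod Measure.count) (p θ)))
    (hp_summable : ∀ θ ∈ Θ, ∀ x, Summable fun y => p θ (x, y))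
    (hp_ident : SemiSup.Identifiable (μ.prod Measure.count) p Θ)
    (hp_joint : SemiSup.RegularFamily (μ.prod Measure.count) p Θ θ₀)
    (hp_marginal : SemiSup.RegularFamily μ (SemiSup.marginal p) Θ θ₀)
    (lam : ℝ) (hlam_pos : 0 < lam) (hlam_le : lam ≤ 1)
    (h_nonsing : (SemiSup.infoMatrix μ p lam θ₀).det ≠ 0)
    (X : ℕ → Ω → 𝒳) (Y : ℕ → Ω → 𝒴) (Z : ℕ → Ω → ℝ)
    (h_indep : iIndepFun (fun i ω => ((X i ω, Y i ω), Z i ω)) P)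
    (h_law : ∀ i, HasLaw (fun ω => ((X i ω, Y i ω), Z i ω))
      ((SemiSup.law (μ.prod Measure.count) (p θ₀)).prod (SemiSup.indicatorLaw lam)) P)
    (θhat : ℕ → Ω → SemiSup.Param r)
    (hθhat_meas : ∀ n, AEMeasurable (θhat n) P)
    (hθhat : ∀ n, ∀ᵐ ω ∂P, θhat n ω ∈ Θ ∧
      IsMaxOn (SemiSup.logLik p (fun i => X i ω) (fun i => Y i ω) (fun i => Z i ω) n) Θ
        (θhat n ω)) :
    MemLp (SemiSup.score p θ₀) 2 (SemiSup.law (μ.prod Measure.count) (p θ₀)) ∧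
    MemLp (SemiSup.score (SemiSup.marginal p) θ₀) 2
      (SemiSup.law μ (SemiSup.marginal p θ₀)) ∧
    TendstoInDistribution (fun (n : ℕ) ω => √(n : ℝ) • (θhat n ω - θ₀)) atTop id
      (fun _ => P) (multivariateGaussian 0 (SemiSup.infoMatrix μ p lam θ₀)⁻¹) := by
  have hθ₀' := interior_subset hθ₀
  -- Positivity of the marginal needs at least one label; a value of `Y 0` supplies it, as a
  -- probability space is nonempty.
  have : Nonempty 𝒴 := by
    have := nonempty_of_isProbabilityMeasure P
    exact this.map (Y 0)
  have hpos' : ∀ θ ∈ Θ, ∀ x, 0 < SemiSup.marginal p θ x := fun θ hθ =>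
    SemiSup.marginal_pos (hp_pos θ hθ) (hp_summable θ hθ)
  have hmeas' : ∀ θ ∈ Θ, Measurable (SemiSup.marginal p θ) := fun θ hθ =>
    SemiSup.measurable_marginal (hp_meas θ hθ) (hp_pos θ hθ) (hp_summable θ hθ)
  have hfst : ∀ θ ∈ Θ, MeasurePreserving Prod.fst
      (SemiSup.law (μ.prod Measure.count) (p θ)) (SemiSup.law μ (SemiSup.marginal p θ)) :=
    fun θ hθ => ⟨measurable_fst,
      SemiSup.map_fst_law (hp_meas θ hθ) (hp_pos θ hθ) (hp_summable θ hθ)⟩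
  -- The marginal law is the image of the joint law under the first projection, so it inherits total
  -- mass one.
  have hprob' : ∀ θ ∈ Θ, IsProbabilityMeasure (SemiSup.law μ (SemiSup.marginal p θ)) := by
    intro θ hθ
    have := hp_prob θ hθ
    rw [← (hfst θ hθ).map_eq]
    exact Measure.isProbabilityMeasure_map measurable_fst.aemeasurable
  refine ⟨SemiSup.memLp_score hp_joint hp_pos hp_meas hp_prob hθ₀,
    SemiSup.memLp_score hp_marginal hpos' hmeas' hprob' hθ₀,
    SemiSup.semiSupervised_tendstoInDistribution hΘ hθ₀ hp_meas hp_pos hp_prob hmeas' hpos' hprob'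
      (hfst θ₀ hθ₀') hp_ident hp_joint hp_marginal hlam_pos hlam_le rfl h_nonsing h_indep h_law
      hθhat_meas fun n => ?_⟩
  filter_upwards [hθhat n] with ω hω
  simpa only [← SemiSup.logLik_eq_sum] using hω
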